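/- Let $n\ge 1$ and $p\ge 0$ be integers, $\mathcal H=\mathbb C^2$, and let $\mathsf A,\mathsf B_1,\dots,\mathsf B_p$ be skew-Hermitian operators on the $n$-qubit space $\mathcal H^{\otimes n}$, where the drift has the form $\mathsf A=\imath\,\mathsf H_0^{\otimes n}$ for some operator $\mathsf H_0$ on $\mathcal H$. Let $T>0$. A control is a function $u=(u_1,\dots,u_p):[0,\infty)\to\mathbb R^p$ that is measurable and bounded on bounded intervals; solutions of differential equations are understood in the sense of Carathéodory. The measured qubit network with period $T$ is the following hybrid system. A global measurement $\mathsf M^{\otimes n}$ is given by a one-qubit observable $\mathsf M=\lambda_0|v_0\rangle\langle v_0|+\lambda_1|v_1\rangle\langle v_1|$ with real $\lambda_0\ne\lambda_1$ and $v_0,v_1$ an orthonormal basis of $\mathcal H$; measuring a state (unit vector) $\psi$ gives the outcome $m\in\{0,1\}^n$ with probability $|\langle v_{m_1}\otimes\cdots\otimes v_{m_n},\psi\rangle|^2$ and leaves the network in the state $v_{m_1}\otimes\cdots\otimes v_{m_n}$. At the times $0,T,2T,\dots$ the network is measured in this way, and on each interval $[tT,(t+1)T)$ its state evolves from the post-measurement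 state by $\dot q(s)=\big(\mathsf A+\sum_{\ell=1}^p u_\ell(s)\mathsf B_\ell\big)q(s)$, where the control on this interval may depend on the post-measurement states at the times $0,T,\dots,tT$ (feedback). Let $\psi(t)$ denote the state right before the measurement at time $tT$. The network is called quantum equivalent state controllable if for any two states $\psi_0,\psi_1\in\mathcal H^{\otimes n}$ there exist an integer $T_0>0$, a global measurement $\mathsf M^{\otimes n}$, feedback controls, and a real $\phi$ such that the network with $\psi(0)=\psi_0$ satisfies $\psi(T_0)=e^{\imath\phi}\psi_1$ with probability one. Let $\mathcal L=\mathcal L\{\mathsf A,\mathsf B_1,\dots,\mathsf B_p\}$ be the real Lie algebra generated by $\mathsf A,\mathsf B_1,\dots,\mathsf B_p$ under the commutator, and $e^{\mathcal L}=\{\exp(t\mathsf X):t\in\mathbb R,\ \mathsf X\in\mathcal L\}$. For $s\ge 0$ let $R(\mathrm I,s)$ be the set of those $\mathsf U\in e^{\mathcal L}$ with $\mathsf U=\mathsf X(s)$ for the solution of $\dot{\mathsf X}=\big(\mathsf A+\sum_{\ell}u_\ell\mathsf B_\ell\big)\mathsf X$, $\mathsf X(0)=\mathrm I$, under some control, and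 let $\mathbf R(\mathrm I,T)=\bigcup_{0\le s\le T}R(\mathrm I,s)$. Let $\mathfrak{su}(N)$ be the real Lie algebra of traceless skew-Hermitian $N\times N$ matrices, and $\mathfrak{sp}(N)=\{X\in\mathfrak{su}(2N): XJ+JX^\top=0\}$ with $J=\begin{pmatrix}0&I_N\\-I_N&0\end{pmatrix}$. Suppose that (i) $\mathcal L$ is isomorphic, as a real Lie algebra, to $\mathfrak{sp}(2^{n-1})$ or to $\mathfrak{su}(2^n)$; (ii) $T$ is so large that $\mathbf R(\mathrm I,T)=e^{\mathcal L}$. Then the measured qubit network is quantum equivalent state controllable. -/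

import Mathlib

open Matrix MeasureTheory

attribute [local instance 100] LieRing.ofAssociativeRing

noncomputable section

namespace QubitNetwork

/-! ### The state space of `n` qubits -/

/-- Labels of the computational basis of `n` qubits: bit strings `x₁ … xₙ`.  The same type labels
the outcomes of a measurement of all the qubits. -/
abbrev Bits (n : ℕ) : Type := Fin n → Fin 2

/-- The `n`-fold tensor power of the one-qubit space `ℂ²`, in coordinates with respect to the
computational basis.  States are the unit vectors. -/
abbrev StateSpace (n : ℕ) : Type := EuclideanSpace ℂ (Bits n)

/-- Linear operators on the `n`-qubit space, as matrices in the computational basis. -/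
abbrev Operator (n : ℕ) : Type := Matrix (Bits n) (Bits n) ℂ

/-- The tensor power `H₀ ⊗ ⋯ ⊗ H₀` (`n` factors) of a one-qubit operator. -/
def tensorPower (n : ℕ) (H₀ : Matrix (Fin 2) (Fin 2) ℂ) : Operator n :=
  Matrix.of fun x y => ∏ i, H₀ (x i) (y i)

/-! ### Bilinear control -/

/-- Admissible control signals: measurable and bounded on bounded time intervals. -/
def IsAdmissible {p : ℕ} (u : ℝ → Fin p → ℝ) : Prop :=
  (∀ l, Measurable fun s => u s l) ∧
    ∀ τ : ℝ, ∃ C : ℝ, ∀ s ∈ Set.Icc 0 τ, ∀ l, |u s l| ≤ C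

/-- The controlled generator `A + ∑ u_l B_l`. -/
def generator {n p : ℕ} (A : Operator n) (B : Fin p → Operator n) (c : Fin p → ℝ) : Operator n :=
  A + ∑ l, (c l : ℂ) • B l

/-- `X` solves `X' = (A + ∑ u_l B_l) X`, `X 0 = 1` on `[0, s]`, in the sense of Carathéodory. -/
def IsPropagator {n p : ℕ} (A : Operator n) (B : Fin p → Operator n) (u : ℝ → Fin p → ℝ)
    (s : ℝ) (X : ℝ → Operator n) : Prop :=
  ContinuousOn X (Set.Icc 0 s) ∧
    ∀ t ∈ Set.Icc 0 s, ∀ x y,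
      X t x y = (1 : Operator n) x y + ∫ r in (0 : ℝ)..t, (generator A B (u r) * X r) x y

/-- `q` solves `q' = (A + ∑ u_l B_l) q`, `q 0 = q₀` on `[0, s]`, in the sense of Carathéodory. -/
def IsSolution {n p : ℕ} (A : Operator n) (B : Fin p → Operator n) (u : ℝ → Fin p → ℝ)
    (s : ℝ) (q₀ : StateSpace n) (q : ℝ → StateSpace n) : Prop :=
  ContinuousOn q (Set.Icc 0 s) ∧
    ∀ t ∈ Set.Icc 0 s, ∀ x,
      q t x = q₀ x + ∫ r in (0 : ℝ)..t, (generator A B (u r) *ᵥ (q r).ofLp) x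

/-! ### Lie algebras, their exponentials, and reachable sets -/

/-- The real Lie algebra generated by `A, B₁, …, B_p`. -/
def generatedLieAlgebra {n p : ℕ} (A : Operator n) (B : Fin p → Operator n) :
    LieSubalgebra ℝ (Operator n) :=
  LieSubalgebra.lieSpan ℝ (Operator n) (insert A (Set.range B))

/-- `su`: the real Lie algebra of traceless skew-Hermitian matrices. -/
def su (ι : Type) [Fintype ι] [DecidableEq ι] : LieSubalgebra ℝ (Matrix ι ι ℂ) where
  carrier := {X | Xᴴ = -X ∧ X.trace = 0}
  add_mem' := by
    rintro X Y ⟨hX, hX'⟩ ⟨hY, hY'⟩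
    refine ⟨?_, ?_⟩
    · rw [conjTranspose_add, hX, hY, neg_add]
    · rw [trace_add, hX', hY', add_zero]
  zero_mem' := by simp
  smul_mem' := by
    rintro c X ⟨hX, hX'⟩
    refine ⟨?_, ?_⟩
    · rw [conjTranspose_smul, hX, star_trivial, smul_neg]
    · rw [trace_smul, hX', smul_zero]
  lie_mem' := by
    rintro X Y ⟨hX, -⟩ ⟨hY, -⟩
    refine ⟨?_, ?_⟩
    · rw [Ring.lie_def, conjTranspose_sub, conjTranspose_mul, conjTranspose_mul, hX, hY]
      noncomm_ring
    · rw [Ring.lie_def, trace_sub, trace_mul_comm, sub_self]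

/-- The matrix `J = (0, I; -I, 0)` of size `2m`. -/
def sympJ (m : ℕ) : Matrix (Fin m ⊕ Fin m) (Fin m ⊕ Fin m) ℂ :=
  Matrix.fromBlocks 0 1 (-1) 0

/-- `sp(m)`: the real Lie algebra of those `X` in `su(2m)` with `X J + J Xᵀ = 0`. -/
def sp (m : ℕ) : LieSubalgebra ℝ (Matrix (Fin m ⊕ Fin m) (Fin m ⊕ Fin m) ℂ) where
  carrier := {X | X ∈ su (Fin m ⊕ Fin m) ∧ X * sympJ m + sympJ m * Xᵀ = 0}
  add_mem' := by
    rintro X Y ⟨hX, hX'⟩ ⟨hY, hY'⟩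
    refine ⟨add_mem hX hY, ?_⟩
    calc (X + Y) * sympJ m + sympJ m * (X + Y)ᵀ
        = (X * sympJ m + sympJ m * Xᵀ) + (Y * sympJ m + sympJ m * Yᵀ) := by
          rw [transpose_add]; noncomm_ring
      _ = 0 := by rw [hX', hY', add_zero]
  zero_mem' := ⟨zero_mem _, by simp⟩
  smul_mem' := by
    rintro c X ⟨hX, hX'⟩
    refine ⟨(su _).smul_mem c hX, ?_⟩
    rw [transpose_smul, smul_mul_assoc, mul_smul_comm, ← smul_add, hX', smul_zero]
  lie_mem' := by
    rintro X Y ⟨hX, hX'⟩ ⟨hY, hY'⟩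
    refine ⟨(su _).lie_mem hX hY, ?_⟩
    have h1 : X * sympJ m = -(sympJ m * Xᵀ) := eq_neg_of_add_eq_zero_left hX'
    have h2 : Y * sympJ m = -(sympJ m * Yᵀ) := eq_neg_of_add_eq_zero_left hY'
    have h3 : X * Y * sympJ m = sympJ m * (Xᵀ * Yᵀ) := by
      rw [mul_assoc, h2, mul_neg, ← mul_assoc, h1, neg_mul, neg_neg, mul_assoc]
    have h4 : Y * X * sympJ m = sympJ m * (Yᵀ * Xᵀ) := by
      rw [mul_assoc, h1, mul_neg, ← mul_assoc, h2, neg_mul, neg_neg, mul_assoc]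
    rw [Ring.lie_def, transpose_sub, transpose_mul, transpose_mul, sub_mul, h3, h4]
    noncomm_ring

/-- The Lie group `{exp (t X) : t ∈ ℝ, X ∈ L}` associated with a Lie algebra `L`. -/
def expGroup {n : ℕ} (L : LieSubalgebra ℝ (Operator n)) : Set (Operator n) :=
  {U | ∃ t : ℝ, ∃ X ∈ L, U = NormedSpace.exp (t • X)}

/-- `R(I, s)`: the operators in the Lie group that are reached from the identity at time
exactly `s`. -/
def reachableAt {n p : ℕ} (A : Operator n) (B : Fin p → Operator n) (s : ℝ) :
    Set (Operator n) :=
  {U | U ∈ expGroup (generatedLieAlgebra A B) ∧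
    ∃ u : ℝ → Fin p → ℝ, IsAdmissible u ∧ ∃ X, IsPropagator A B u s X ∧ X s = U}

/-- The operators that are reached from the identity within time `T`. -/
def reachableWithin {n p : ℕ} (A : Operator n) (B : Fin p → Operator n) (T : ℝ) :
    Set (Operator n) :=
  ⋃ s ∈ Set.Icc 0 T, reachableAt A B s

/-! ### Global measurements and the measured network -/

/-- A one-qubit observable `λ₀ |v₀⟩⟨v₀| + λ₁ |v₁⟩⟨v₁|` with distinct eigenvalues, together with its
normalized eigenvectors. -/
structure QubitMeasurement where
  eigenvalue : Fin 2 → ℝ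
  eigenvalue_injective : Function.Injective eigenvalue
  eigenvector : OrthonormalBasis (Fin 2) ℂ (EuclideanSpace ℂ (Fin 2))

/-- The state `|v_{m₁}⟩ ⊗ ⋯ ⊗ |v_{mₙ}⟩` in which the network is left when the measurement of every
qubit has given the outcome `[λ_{m₁}, …, λ_{mₙ}]`. -/
def QubitMeasurement.postState (M : QubitMeasurement) {n : ℕ} (m : Bits n) : StateSpace n :=
  WithLp.toLp 2 fun x => ∏ i, M.eigenvector (m i) (x i)

/-- The probability `⟨ψ| P_{m₁} ⊗ ⋯ ⊗ P_{mₙ} |ψ⟩ = |⟨v_{m₁} ⋯ v_{mₙ} | ψ⟩|²` of the outcome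
`[λ_{m₁}, …, λ_{mₙ}]` when the state `ψ` is measured. -/
def QubitMeasurement.outcomeProb (M : QubitMeasurement) {n : ℕ} (ψ : StateSpace n)
    (m : Bits n) : ℝ :=
  ‖inner ℂ (M.postState m) ψ‖ ^ 2

/-- A feedback law: the control signal used between the measurements number `t` and `t + 1`
(counted from `0`) as a function of the post-measurement states number `0, …, t`.  The signal is
given as a function of the time elapsed since measurement number `t`. -/
abbrev FeedbackLaw (n p : ℕ) : Type :=
  (t : ℕ) → (Fin (t + 1) → StateSpace n) → ℝ → Fin p → ℝ

/-- `ψ t ω` is the state of the network right before measurement number `t` (at time `t T`), given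
the outcomes `ω` of the measurements number `0, …, t - 1`: the evolution up to measurement number
`T₀` of the network with period `T`, measurement `M`, feedback law `u` and `ψ(0) = ψ₀`. -/
def IsEvolution {n p : ℕ} (A : Operator n) (B : Fin p → Operator n) (T : ℝ)
    (M : QubitMeasurement) (u : FeedbackLaw n p) (T₀ : ℕ) (ψ₀ : StateSpace n)
    (ψ : (t : ℕ) → (Fin t → Bits n) → StateSpace n) : Prop :=
  (∀ ω, ψ 0 ω = ψ₀) ∧
    ∀ t < T₀, ∀ ω : Fin (t + 1) → Bits n, ∃ q : ℝ → StateSpace n,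
      IsSolution A B (u t fun i => M.postState (ω i)) T (M.postState (ω (Fin.last t))) q ∧
        q T = ψ (t + 1) ω

/-- The probability that the measurements number `0, …, t - 1` have the outcomes `ω`, when the
pre-measurement states are `ψ`. -/
def recordProb {n : ℕ} (M : QubitMeasurement)
    (ψ : (t : ℕ) → (Fin t → Bits n) → StateSpace n) : (t : ℕ) → (Fin t → Bits n) → ℝ
  | 0, _ => 1
  | t + 1, ω => recordProb M ψ t (Fin.init ω) *
      M.outcomeProb (ψ t (Fin.init ω)) (ω (Fin.last t))

open Classical in
/-- The probability that the state right before measurement number `t` is `χ`. -/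
def stateProb {n : ℕ} (M : QubitMeasurement)
    (ψ : (t : ℕ) → (Fin t → Bits n) → StateSpace n) (t : ℕ) (χ : StateSpace n) : ℝ :=
  ∑ ω : Fin t → Bits n, if ψ t ω = χ then recordProb M ψ t ω else 0

/-- Quantum equivalent state controllability of the measured network: for any two states
`ψ₀, ψ₁`, some global measurement and some feedback controls steer `ψ(0) = ψ₀` to
`ψ(T₀) = e^{iφ} ψ₁` with probability one, for some `T₀ > 0` and some phase `φ`. -/
def IsEquivalentStateControllable {n p : ℕ} (A : Operator n) (B : Fin p → Operator n)
    (T : ℝ) : Prop :=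
  ∀ ψ₀ ψ₁ : StateSpace n, ‖ψ₀‖ = 1 → ‖ψ₁‖ = 1 →
    ∃ T₀ : ℕ, 0 < T₀ ∧ ∃ M : QubitMeasurement, ∃ u : FeedbackLaw n p, ∃ φ : ℝ,
      (∀ t h, IsAdmissible (u t h)) ∧
      ∃ ψ : (t : ℕ) → (Fin t → Bits n) → StateSpace n,
        IsEvolution A B T M u T₀ ψ₀ ψ ∧
        stateProb M ψ T₀ (Complex.exp (Complex.I * φ) • ψ₁) = 1

end QubitNetwork

end

/-! The drift is a multiple of `tensorPower n H₀`, and a scalar multiple of `H₀` is Hermitian.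
Measuring in an eigenbasis of `H₀` therefore leaves the network in eigenvectors of `A`
(`exists_measurement_diagonalizing`). With the controls off such a state only acquires a phase, so
an operator reachable in some time `s ≤ T` can be applied in time exactly `T`, up to a phase, by
waiting for `T - s` first (`exists_isSolution_of_eigenvector`). By the hypothesis on reachable sets
this covers every `exp X` with `X` in the Lie algebra.

If these exponentials act transitively on the unit sphere up to phase (`TransitiveUpToPhase`), two
periods suffice. The first steers every outcome to one fixed product vector of the measured basis;
the second measurement is then deterministic, and the second period steers this vector to `ψ₁`
(`isEquivalentStateControllable_of_transitive`). The detour makes the final phase independent of the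
first outcome.

It remains to deduce transitivity from an abstract isomorphism type. By
`TransitiveUpToPhase.of_rotation` it is enough to rotate orthonormal pairs. For `su`, removing
traces maps the Lie algebra injectively, hence by dimension onto all of `su`
(`transitiveUpToPhase_of_equiv_su`). For `sp m` with `m ≥ 2`, the inverse isomorphism is a
skew-Hermitian representation of dimension `2 * m`, which is complexified (`exists_spRep`).
Positivity gives enough weights for a count to leave only `±ε_a` (`eq_range_stdWeight`). A weight
vector then defines an intertwiner with the standard representation (`mul_intertwiner`), unitary up
to scaling (`conjTranspose_intertwiner_mul`), and transitivity is transported from explicit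
rotations in `sp` (`exists_mem_sp_rotation`). For `m = 1`, `sp 1` is `su` of size two. -/

/-! ### Exponentials of matrices -/

section Exponential

variable {κ : Type*} [Fintype κ] [DecidableEq κ]

open scoped Matrix.Norms.Operator in
theorem Matrix.exp_mulVec_of_mulVec_eq_smul {A : Matrix κ κ ℂ} {v : κ → ℂ} {c : ℂ}
    (h : A *ᵥ v = c • v) : NormedSpace.exp A *ᵥ v = Complex.exp c • v := by
  have hpow : ∀ k : ℕ, A ^ k *ᵥ v = c ^ k • v := by
    intro k
    induction k with
    | zero => simp
    | succ k ih => rw [pow_succ, ← mulVec_mulVec, h, mulVec_smul, ih, smul_smul, pow_succ, mul_comm]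
  let φ : Matrix κ κ ℂ →ₗ[ℂ] (κ → ℂ) :=
    { toFun := fun X => X *ᵥ v
      map_add' := fun X Y => add_mulVec X Y v
      map_smul' := fun a X => smul_mulVec a X v }
  have h1 : HasSum (fun k : ℕ => φ ((k.factorial⁻¹ : ℂ) • A ^ k)) (φ (NormedSpace.exp A)) :=
    (NormedSpace.exp_series_hasSum_exp' (𝕂 := ℂ) A).mapL (LinearMap.toContinuousLinearMap φ)
  have h2 : HasSum (fun k : ℕ => ((k.factorial⁻¹ : ℂ) • c ^ k) • v) (NormedSpace.exp c • v) :=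
    (NormedSpace.exp_series_hasSum_exp' (𝕂 := ℂ) c).smul_const v
  rw [Complex.exp_eq_exp_ℂ]
  refine h1.unique ?_
  convert h2 using 2 with k
  change ((k.factorial⁻¹ : ℂ) • A ^ k) *ᵥ v = _
  rw [smul_mulVec, hpow, smul_assoc]

/-- The vectors `x ∓ i z` are eigenvectors of `A` with eigenvalues `±i`, and `x` is half their sum.
-/
theorem Matrix.exp_mulVec_of_rotation {A : Matrix κ κ ℂ} {x z : κ → ℂ} (θ : ℝ)
    (hx : A *ᵥ x = z) (hz : A *ᵥ z = -x) :
    NormedSpace.exp (θ • A) *ᵥ x = (Real.cos θ : ℂ) • x + (Real.sin θ : ℂ) • z := by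
  have e : θ • A = (θ : ℂ) • A := (Complex.coe_smul θ A).symm
  have h1 : (θ • A) *ᵥ (x - Complex.I • z) = (θ * Complex.I) • (x - Complex.I • z) := by
    rw [e, smul_mulVec, mulVec_sub, mulVec_smul, hx, hz, mul_smul, smul_sub Complex.I, smul_smul,
      Complex.I_mul_I]
    congr 1
    module
  have h2 : (θ • A) *ᵥ (x + Complex.I • z) = (-θ * Complex.I) • (x + Complex.I • z) := by
    rw [e, smul_mulVec, mulVec_add, mulVec_smul, hx, hz, neg_mul, neg_smul, mul_smul,
      smul_add Complex.I, smul_smul, Complex.I_mul_I]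
    rw [← smul_neg]
    congr 1
    module
  have h3 : x = (1 / 2 : ℂ) • (x - Complex.I • z) + (1 / 2 : ℂ) • (x + Complex.I • z) := by module
  conv_lhs => rw [h3]
  rw [mulVec_add, mulVec_smul, mulVec_smul, exp_mulVec_of_mulVec_eq_smul h1,
    exp_mulVec_of_mulVec_eq_smul h2, Complex.exp_mul_I, Complex.exp_mul_I, Complex.cos_neg,
    Complex.sin_neg, Complex.ofReal_cos, Complex.ofReal_sin]
  have hI : ∀ w : κ → ℂ, Complex.I • Complex.I • w = -w := fun w => by
    rw [smul_smul, Complex.I_mul_I, neg_one_smul]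
  funext k
  simp only [Pi.add_apply, Pi.sub_apply, Pi.smul_apply, smul_eq_mul]
  linear_combination (-Complex.sin θ * z k) * Complex.I_mul_I

end Exponential

namespace QubitNetwork

/-! ### Solutions of the controlled equation -/

section Solution

variable {n p : ℕ} {A : Operator n} {B : Fin p → Operator n}

theorem IsAdmissible.intervalIntegrable {u : ℝ → Fin p → ℝ} (hu : IsAdmissible u) {a b : ℝ}
    (ha : 0 ≤ a) (hab : a ≤ b) (l : Fin p) :
    IntervalIntegrable (fun r => (u r l : ℂ)) volume a b := by
  obtain ⟨C, hC⟩ := hu.2 b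
  rw [intervalIntegrable_iff_integrableOn_Icc_of_le hab]
  refine Measure.integrableOn_of_bounded (M := C) (by simp) ?_ ?_
  · exact (Complex.measurable_ofReal.comp (hu.1 l)).aestronglyMeasurable
  · filter_upwards [ae_restrict_mem measurableSet_Icc] with r hr
    simpa using hC r ⟨ha.trans hr.1, hr.2⟩ l

theorem IsAdmissible.intervalIntegrable_generator {u : ℝ → Fin p → ℝ} (hu : IsAdmissible u)
    {a b : ℝ} (ha : 0 ≤ a) (hab : a ≤ b) (x y : Bits n) :
    IntervalIntegrable (fun r => generator A B (u r) x y) volume a b := by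
  have : (fun r => generator A B (u r) x y) =
      fun r => A x y + ∑ l, (u r l : ℂ) * B l x y := by
    funext r
    simp [generator, Matrix.sum_apply]
  rw [this]
  refine intervalIntegrable_const.add ?_
  have h := IntervalIntegrable.sum Finset.univ (f := fun l r => (u r l : ℂ) * B l x y)
    fun l _ => (hu.intervalIntegrable ha hab l).mul_const _
  refine h.congr fun r _ => ?_
  simp

theorem IsAdmissible.intervalIntegrable_mulVec {u : ℝ → Fin p → ℝ} (hu : IsAdmissible u)
    {a b : ℝ} (ha : 0 ≤ a) (hab : a ≤ b) {q : ℝ → Bits n → ℂ}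
    (hq : ∀ y, ContinuousOn (fun r => q r y) (Set.Icc a b)) (x : Bits n) :
    IntervalIntegrable (fun r => (generator A B (u r) *ᵥ q r) x) volume a b := by
  have := IntervalIntegrable.sum (μ := volume) (a := a) (b := b) Finset.univ
    (f := fun y r => generator A B (u r) x y * q r y)
    fun y _ => (hu.intervalIntegrable_generator ha hab x y).mul_continuousOn
      (by rw [Set.uIcc_of_le hab]; exact hq y)
  refine this.congr fun r _ => ?_
  simp [mulVec, dotProduct]

theorem IsPropagator.apply_zero {u : ℝ → Fin p → ℝ} {s : ℝ} {X : ℝ → Operator n}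
    (hX : IsPropagator A B u s X) (hs : 0 ≤ s) : X 0 = 1 := by
  ext x y
  simpa using hX.2 0 ⟨le_rfl, hs⟩ x y

theorem IsPropagator.mulVec_eq {u : ℝ → Fin p → ℝ} (hu : IsAdmissible u) {s : ℝ}
    {X : ℝ → Operator n} (hX : IsPropagator A B u s X) (w : Bits n → ℂ) {t : ℝ}
    (ht : t ∈ Set.Icc 0 s) (x : Bits n) :
    (X t *ᵥ w) x = w x + ∫ r in (0 : ℝ)..t, (generator A B (u r) *ᵥ (X r *ᵥ w)) x := by
  have hint : ∀ y, IntervalIntegrable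
        (fun r => (generator A B (u r) * X r) x y) volume 0 t := by
    intro y
    refine (hu.intervalIntegrable_mulVec (A := A) (B := B) le_rfl ht.1
      (q := fun r z => X r z y) (fun z => ?_) x).congr fun r _ => ?_
    · exact ((continuous_apply_apply z y).comp_continuousOn hX.1).mono
        (Set.Icc_subset_Icc le_rfl ht.2)
    · simp [mulVec, Matrix.mul_apply, dotProduct]
  have h1 : ∀ r, (generator A B (u r) *ᵥ (X r *ᵥ w)) x =
      ∑ y, (generator A B (u r) * X r) x y * w y := by
    intro r
    rw [mulVec_mulVec]
    rfl
  simp_rw [h1]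
  rw [intervalIntegral.integral_finsetSum fun y _ => (hint y).mul_const _]
  simp_rw [intervalIntegral.integral_mul_const]
  have h2 : w x = ∑ y, (1 : Operator n) x y * w y := by
    conv_lhs => rw [← one_mulVec w]
    rfl
  rw [h2, ← Finset.sum_add_distrib]
  refine Finset.sum_congr rfl fun y _ => ?_
  rw [← add_mul, ← hX.2 t ht x y]

/-- The control that vanishes until time `τ` and then follows `u`. -/
noncomputable def delayedControl (τ : ℝ) (u : ℝ → Fin p → ℝ) (t : ℝ) (l : Fin p) : ℝ :=
  if t < τ then 0 else u (t - τ) l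

theorem IsAdmissible.delayedControl {u : ℝ → Fin p → ℝ} (hu : IsAdmissible u) (τ : ℝ) :
    IsAdmissible (delayedControl τ u) := by
  refine ⟨fun l => ?_, fun σ => ?_⟩
  · exact Measurable.ite measurableSet_Iio measurable_const
      ((hu.1 l).comp (measurable_id.sub_const τ))
  · obtain ⟨C, hC⟩ := hu.2 (σ - τ)
    refine ⟨max C 0, fun s hs l => ?_⟩
    unfold QubitNetwork.delayedControl
    split_ifs with h
    · simp
    · exact (hC _ ⟨by linarith, by linarith [hs.2]⟩ l).trans (le_max_left _ _)

/-- From an eigenvector of the drift every reachable operator can be applied with a delay. -/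
theorem exists_isSolution_of_eigenvector {T s : ℝ} (hs : s ∈ Set.Icc 0 T)
    {u : ℝ → Fin p → ℝ} (hu : IsAdmissible u) {X : ℝ → Operator n}
    (hX : IsPropagator A B u s X) {v : StateSpace n} {c : ℂ}
    (hv : A *ᵥ v.ofLp = c • v.ofLp) :
    ∃ q, IsSolution A B (delayedControl (T - s) u) T v q ∧
      (q T).ofLp = Complex.exp (c * (T - s : ℝ)) • (X s *ᵥ v.ofLp) := by
  set τ := T - s with hτ
  have hτ0 : 0 ≤ τ := by linarith [hs.2]
  have hX0 := hX.apply_zero hs.1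
  set w : Bits n → ℂ := Complex.exp (c * (τ : ℝ)) • v.ofLp with hw
  -- One formula for both stages: up to `τ` the propagator stays at `X 0 = 1` while the phase runs;
  -- after `τ` the phase is frozen and the propagator runs.
  let q : ℝ → StateSpace n := fun t =>
    WithLp.toLp 2 (X (max 0 (t - τ)) *ᵥ (Complex.exp (c * (min t τ : ℝ)) • v.ofLp))
  have hq1 : ∀ t, t ≤ τ → (q t).ofLp = Complex.exp (c * (t : ℝ)) • v.ofLp := by
    intro t ht
    simp [q, max_eq_left (sub_nonpos.2 ht), hX0, min_eq_left ht]
  have hq2 : ∀ t, τ ≤ t → (q t).ofLp = X (t - τ) *ᵥ w := by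
    intro t ht
    simp [q, max_eq_right (sub_nonneg.2 ht), min_eq_right ht, hw]
  have hcont : ContinuousOn q (Set.Icc 0 T) := by
    have h1 : ContinuousOn (fun t => X (max 0 (t - τ))) (Set.Icc 0 T) := by
      refine hX.1.comp (by fun_prop) fun t ht => ⟨le_max_left _ _, max_le hs.1 ?_⟩
      linarith [ht.2]
    have h2 : Continuous fun t : ℝ => Complex.exp (c * (min t τ : ℝ)) • v.ofLp := by fun_prop
    refine (PiLp.continuous_toLp 2 _).comp_continuousOn (continuousOn_pi.2 fun x => ?_)
    simp only [mulVec, dotProduct]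
    refine continuousOn_finsetSum _ fun y _ => ?_
    exact ((continuous_apply_apply x y).comp_continuousOn h1).mul
      ((continuous_apply y).comp h2).continuousOn
  have hcomp : ∀ y, ContinuousOn (fun r => (q r).ofLp y) (Set.Icc 0 T) := fun y =>
    ((continuous_apply y).comp (PiLp.continuous_ofLp 2 _)).comp_continuousOn hcont
  have hu' := hu.delayedControl τ
  have hfirst : ∀ t, 0 ≤ t → t ≤ τ → ∀ x, ∫ r in (0 : ℝ)..t,
      (generator A B (delayedControl τ u r) *ᵥ (q r).ofLp) x =
        Complex.exp (c * (t : ℝ)) * v x - v x := by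
    intro t ht0 ht x
    have hderiv : ∀ r : ℝ, HasDerivAt (fun r : ℝ => Complex.exp (c * (r : ℝ)) * v x)
        (c * Complex.exp (c * (r : ℝ)) * v x) r := by
      intro r
      have h1 : HasDerivAt (fun r : ℝ => c * (r : ℂ)) c r := by
        simpa using (Complex.ofRealCLM.hasDerivAt (x := r)).const_mul c
      simpa [mul_comm] using (h1.cexp).mul_const (v x)
    have h2 := intervalIntegral.integral_eq_sub_of_hasDerivAt (a := 0) (b := t)
      (fun r _ => hderiv r) (Continuous.intervalIntegrable (by fun_prop) _ _)
    simp only [Complex.ofReal_zero, mul_zero, Complex.exp_zero, one_mul] at h2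
    rw [← h2]
    refine intervalIntegral.integral_congr_ae ?_
    -- At `r = τ` the delayed control already follows `u`, so this single point is discarded as a
    -- null set.
    have hne : ∀ᵐ r : ℝ ∂volume, r ≠ τ := by
      simp [ae_iff]
    filter_upwards [hne] with r hr hmem
    rw [Set.uIoc_of_le ht0] at hmem
    have hlt : r < τ := lt_of_le_of_ne (hmem.2.trans ht) hr
    have h0 : generator A B (delayedControl τ u r) = A := by
      simp [generator, delayedControl, hlt]
    rw [h0, hq1 r hlt.le, mulVec_smul, hv]
    simp only [Pi.smul_apply, smul_eq_mul]
    ring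
  have hqT : (q T).ofLp = Complex.exp (c * (τ : ℝ)) • (X s *ᵥ v.ofLp) := by
    rw [hq2 T (by linarith [hs.1]), show T - τ = s by rw [hτ]; ring, hw, mulVec_smul]
  refine ⟨q, ⟨hcont, fun t ht x => ?_⟩, hqT⟩
  rcases le_total t τ with htτ | htτ
  · rw [hfirst t ht.1 htτ x, hq1 t htτ]
    simp
  · rw [← intervalIntegral.integral_add_adjacent_intervals
      (hu'.intervalIntegrable_mulVec le_rfl hτ0
        (fun y => (hcomp y).mono (Set.Icc_subset_Icc le_rfl (htτ.trans ht.2))) x)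
      (hu'.intervalIntegrable_mulVec hτ0 htτ
        (fun y => (hcomp y).mono (Set.Icc_subset_Icc hτ0 ht.2)) x), hfirst τ hτ0 le_rfl x]
    have h1 : ∫ r in τ..t, (generator A B (delayedControl τ u r) *ᵥ (q r).ofLp) x =
        ∫ r in τ..t, (fun r => (generator A B (u r) *ᵥ (X r *ᵥ w)) x) (r - τ) := by
      refine intervalIntegral.integral_congr fun r hr => ?_
      rw [Set.uIcc_of_le htτ] at hr
      have h0 : generator A B (delayedControl τ u r) = generator A B (u (r - τ)) := by
        unfold generator delayedControl
        simp [not_lt.2 hr.1]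
      simp only [h0, hq2 r hr.1]
    rw [h1, intervalIntegral.integral_comp_sub_right (fun r =>
      (generator A B (u r) *ᵥ (X r *ᵥ w)) x) τ, sub_self, hq2 t htτ,
      hX.mulVec_eq hu w ⟨by linarith, by linarith [ht.2]⟩ x]
    simp only [hw, Pi.smul_apply, smul_eq_mul]
    ring

end Solution
end QubitNetwork

namespace QubitNetwork

/-! ### Global measurements -/

section Measurement

variable {n : ℕ}

theorem QubitMeasurement.inner_postState (M : QubitMeasurement) (m m' : Bits n) :
    inner ℂ (M.postState m) (M.postState m') = if m = m' then 1 else 0 := by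
  have h1 : ∀ i, ∑ b : Fin 2, M.eigenvector (m' i) b * star (M.eigenvector (m i) b) =
      if m i = m' i then 1 else 0 := by
    intro i
    rw [← orthonormal_iff_ite.1 M.eigenvector.orthonormal (m i) (m' i), PiLp.inner_apply]
    simp
  have h2 : inner ℂ (M.postState m) (M.postState m') =
      ∑ x : Bits n, ∏ i, (M.eigenvector (m' i) (x i) * star (M.eigenvector (m i) (x i))) := by
    rw [PiLp.inner_apply]
    refine Finset.sum_congr rfl fun x _ => ?_
    simp [QubitMeasurement.postState, Finset.prod_mul_distrib]
  rw [h2]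
  have h3 := Finset.prod_univ_sum (fun _ : Fin n => (Finset.univ : Finset (Fin 2)))
    fun i b => M.eigenvector (m' i) b * star (M.eigenvector (m i) b)
  rw [Fintype.piFinset_univ] at h3
  rw [← h3, Finset.prod_congr rfl fun i _ => h1 i, Finset.prod_ite_zero]
  simp [funext_iff]

theorem QubitMeasurement.orthonormal_postState (M : QubitMeasurement) :
    Orthonormal ℂ (M.postState (n := n)) :=
  orthonormal_iff_ite.2 M.inner_postState

theorem QubitMeasurement.sum_outcomeProb (M : QubitMeasurement) (ψ : StateSpace n) :
    ∑ m, M.outcomeProb ψ m = ‖ψ‖ ^ 2 := by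
  let b : OrthonormalBasis (Bits n) ℂ (StateSpace n) :=
    OrthonormalBasis.mk M.orthonormal_postState (by
      rw [M.orthonormal_postState.linearIndependent.span_eq_top_of_card_eq_finrank' (by simp)])
  have hb : ∀ m, b m = M.postState m := fun m => by simp [b]
  rw [← b.sum_sq_norm_inner_right ψ]
  simp [QubitMeasurement.outcomeProb, hb]

theorem QubitMeasurement.outcomeProb_smul_postState (M : QubitMeasurement) {c : ℂ} (hc : ‖c‖ = 1)
    (m m' : Bits n) : M.outcomeProb (c • M.postState m) m' = if m' = m then 1 else 0 := by
  rw [QubitMeasurement.outcomeProb, inner_smul_right, M.inner_postState]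
  split_ifs <;> simp [hc]

/-- A one-qubit operator with a Hermitian tensor power is a multiple of a Hermitian operator. -/
theorem exists_isHermitian_of_tensorPower (hn : 1 ≤ n) {H₀ : Matrix (Fin 2) (Fin 2) ℂ}
    (h : (tensorPower n H₀).IsHermitian) :
    ∃ c : ℂ, c ≠ 0 ∧ (c • H₀).IsHermitian := by
  by_cases h0 : H₀ = 0
  · exact ⟨1, one_ne_zero, by simp [h0]⟩
  obtain ⟨a, b, hab⟩ : ∃ a b, H₀ a b ≠ 0 := by
    by_contra! hc
    exact h0 (by ext a b; simp [hc])
  obtain ⟨k, rfl⟩ : ∃ k, n = k + 1 := ⟨n - 1, by omega⟩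
  -- Compare the entries in row `(c, a, …, a)` and column `(d, b, …, b)`: one factor varies, the
  -- others stay at the nonzero entry.
  have hentry : ∀ c d, H₀ c d * H₀ a b ^ k = star (H₀ d c) * star (H₀ b a) ^ k := by
    intro c d
    have := congrFun (congrFun h (Fin.cons c fun _ => a)) (Fin.cons d fun _ => b)
    simpa [tensorPower, conjTranspose_apply, Fin.prod_univ_succ] using this.symm
  set ζ : ℂ := (star (H₀ b a) / H₀ a b) ^ k with hζ
  have h1 : ∀ c d, H₀ c d = ζ * star (H₀ d c) := by
    intro c d
    have := hentry c d
    rw [hζ, div_pow]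
    field_simp
    rw [this]; ring
  have hnorm : ‖ζ‖ = 1 := by
    have h2 := congrArg norm (h1 a b)
    have h3 := congrArg norm (h1 b a)
    rw [norm_mul, norm_star] at h2 h3
    have h4 : 0 < ‖H₀ a b‖ := norm_pos_iff.2 hab
    have h5 : ‖ζ‖ * ‖ζ‖ = 1 := by
      have : ‖H₀ a b‖ * (‖ζ‖ * ‖ζ‖) = ‖H₀ a b‖ * 1 := by
        rw [mul_one]; nth_rewrite 2 [h2]; rw [h3]; ring
      exact mul_left_cancel₀ h4.ne' this
    nlinarith [norm_nonneg ζ]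
  -- Now `H₀ = ζ H₀ᴴ` with `|ζ| = 1`; half of this phase, a square root of `star ζ`, makes `μ • H₀`
  -- Hermitian.
  obtain ⟨μ, hμ⟩ := IsAlgClosed.exists_pow_nat_eq (star ζ) two_pos
  rw [sq] at hμ
  replace hμ := hμ.symm
  have hμn : ‖μ‖ = 1 := by
    have h2 := congrArg norm hμ
    rw [norm_star, norm_mul, hnorm] at h2
    nlinarith [norm_nonneg μ]
  have hμμ : star μ * μ = 1 := by
    have := Complex.conj_mul' μ
    rw [hμn] at this
    simpa using this
  refine ⟨μ, fun h => by simp [h] at hμn, ?_⟩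
  ext c d
  rw [conjTranspose_apply, Matrix.smul_apply, Matrix.smul_apply, smul_eq_mul, smul_eq_mul, star_mul']
  have h2 : star (H₀ d c) = star ζ * H₀ c d := by rw [h1 d c]; simp
  rw [h2, hμ]
  linear_combination (μ * H₀ c d) * hμμ

theorem tensorPower_mulVec_postState {H₀ : Matrix (Fin 2) (Fin 2) ℂ} (M : QubitMeasurement)
    {c : Fin 2 → ℂ} (hM : ∀ b, H₀ *ᵥ (M.eigenvector b).ofLp = c b • (M.eigenvector b).ofLp)
    (m : Bits n) :
    tensorPower n H₀ *ᵥ (M.postState m).ofLp = (∏ i, c (m i)) • (M.postState m).ofLp := by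
  funext x
  have h1 : ∀ i, ∑ b, H₀ (x i) b * M.eigenvector (m i) b = c (m i) * M.eigenvector (m i) (x i) := by
    intro i
    exact congrFun (hM (m i)) (x i)
  simp only [mulVec, dotProduct, tensorPower, of_apply, QubitMeasurement.postState,
    ← Finset.prod_mul_distrib, Pi.smul_apply, smul_eq_mul]
  have h3 := Finset.prod_univ_sum (fun _ : Fin n => (Finset.univ : Finset (Fin 2)))
    fun i b => H₀ (x i) b * M.eigenvector (m i) b
  rw [Fintype.piFinset_univ] at h3
  rw [← h3, Finset.prod_congr rfl fun i _ => h1 i]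

theorem exists_measurement_diagonalizing (hn : 1 ≤ n) {H₀ : Matrix (Fin 2) (Fin 2) ℂ}
    {A : Operator n} (hA : Aᴴ = -A) (hAH : A = Complex.I • tensorPower n H₀) :
    ∃ M : QubitMeasurement, ∀ m : Bits n, ∃ c : ℂ,
      A *ᵥ (M.postState m).ofLp = c • (M.postState m).ofLp := by
  have hherm : (tensorPower n H₀).IsHermitian := by
    rw [hAH, conjTranspose_smul, Complex.star_def, Complex.conj_I, neg_smul, neg_inj] at hA
    exact smul_right_injective _ Complex.I_ne_zero hA
  obtain ⟨μ, hμ, hH⟩ := exists_isHermitian_of_tensorPower hn hherm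
  let M : QubitMeasurement :=
    -- Only the eigenvectors matter. The labels `0, 1` are distinct even when the eigenvalues of
    -- `H₀` coincide.
    { eigenvalue := fun i => (i : ℕ)
      eigenvalue_injective := fun i j h => Fin.ext (Nat.cast_injective (R := ℝ) h)
      eigenvector := hH.eigenvectorBasis }
  have hM : ∀ b, H₀ *ᵥ (M.eigenvector b).ofLp =
      (μ⁻¹ * hH.eigenvalues b) • (M.eigenvector b).ofLp := by
    intro b
    have h1 := hH.mulVec_eigenvectorBasis b
    rw [mul_smul, Complex.coe_smul]
    change _ = μ⁻¹ • hH.eigenvalues b • (hH.eigenvectorBasis b).ofLp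
    rw [← h1, smul_mulVec, smul_smul, inv_mul_cancel₀ hμ, one_smul]
  refine ⟨M, fun m => ⟨Complex.I * ∏ i, (μ⁻¹ * hH.eigenvalues (m i)), ?_⟩⟩
  rw [hAH, smul_mulVec, tensorPower_mulVec_postState M hM, mul_smul]

end Measurement

/-! ### Reduction of controllability to transitivity of the exponentials -/

/-- The operators `exp X`, `X ∈ L`, act transitively on the unit sphere up to phases. -/
def TransitiveUpToPhase {κ : Type*} [Fintype κ] [DecidableEq κ]
    (L : LieSubalgebra ℝ (Matrix κ κ ℂ)) : Prop :=
  ∀ x y : κ → ℂ, star x ⬝ᵥ x = 1 → star y ⬝ᵥ y = 1 →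
    ∃ X ∈ L, ∃ c : ℂ, ‖c‖ = 1 ∧ NormedSpace.exp X *ᵥ x = c • y

theorem star_mulVec_dotProduct {κ : Type*} [Fintype κ] (A : Matrix κ κ ℂ) (v w : κ → ℂ) :
    star (A *ᵥ v) ⬝ᵥ w = star v ⬝ᵥ (Aᴴ *ᵥ w) := by
  rw [star_mulVec, dotProduct_mulVec]

theorem re_eq_zero_of_mulVec_eq_smul {κ : Type*} [Fintype κ] {A : Matrix κ κ ℂ} (hA : Aᴴ = -A)
    {v : κ → ℂ} (hv : star v ⬝ᵥ v = 1) {c : ℂ} (h : A *ᵥ v = c • v) : c.re = 0 := by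
  have h1 := star_mulVec_dotProduct A v v
  rw [hA, neg_mulVec, h, star_smul, smul_dotProduct, dotProduct_neg, dotProduct_smul, hv] at h1
  have := congrArg Complex.re h1
  simp at this
  linarith

theorem star_dotProduct_self_of_norm {ι : Type*} [Fintype ι] (v : EuclideanSpace ℂ ι)
    (hv : ‖v‖ = 1) : star v.ofLp ⬝ᵥ v.ofLp = 1 := by
  have := inner_self_eq_norm_sq_to_K (𝕜 := ℂ) v
  rw [hv, EuclideanSpace.inner_eq_star_dotProduct, dotProduct_comm] at this
  simpa using this

section Reduction

variable {n p : ℕ} {A : Operator n} {B : Fin p → Operator n} {T : ℝ}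

/-- The waiting time contributes the factor `exp (κ (T - s))`, which has modulus one because
eigenvalues of a skew-Hermitian matrix are imaginary. -/
theorem exists_control_of_transitive (hA : Aᴴ = -A)
    (hR : reachableWithin A B T = expGroup (generatedLieAlgebra A B))
    (htrans : TransitiveUpToPhase (generatedLieAlgebra A B)) {v : StateSpace n} (hv1 : ‖v‖ = 1)
    {κ : ℂ} (hv : A *ᵥ v.ofLp = κ • v.ofLp) {χ : StateSpace n} (hχ : ‖χ‖ = 1) :
    ∃ u, IsAdmissible u ∧ ∃ q, IsSolution A B u T v q ∧ ∃ c : ℂ, ‖c‖ = 1 ∧ q T = c • χ := by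
  obtain ⟨X, hX, c, hc, hXc⟩ := htrans v.ofLp χ.ofLp (star_dotProduct_self_of_norm v hv1)
    (star_dotProduct_self_of_norm χ hχ)
  have hmem : NormedSpace.exp X ∈ reachableWithin A B T := by
    rw [hR]
    exact ⟨1, X, hX, by rw [one_smul]⟩
  simp only [reachableWithin, Set.mem_iUnion] at hmem
  obtain ⟨s, hs, -, u, hu, Y, hY, hYs⟩ := hmem
  obtain ⟨q, hq, hqT⟩ := exists_isSolution_of_eigenvector hs hu hY hv
  refine ⟨_, hu.delayedControl _, q, hq, Complex.exp (κ * (T - s : ℝ)) * c, ?_, ?_⟩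
  · rw [norm_mul, hc, Complex.norm_exp]
    have := re_eq_zero_of_mulVec_eq_smul hA (star_dotProduct_self_of_norm v hv1) hv
    simp [this]
  · ext x
    rw [hqT, hYs, hXc, smul_smul]
    rfl

theorem isEquivalentStateControllable_of_transitive (hn : 1 ≤ n) (hA : Aᴴ = -A)
    {H₀ : Matrix (Fin 2) (Fin 2) ℂ} (hAH : A = Complex.I • tensorPower n H₀)
    (hR : reachableWithin A B T = expGroup (generatedLieAlgebra A B))
    (htrans : TransitiveUpToPhase (generatedLieAlgebra A B)) :
    IsEquivalentStateControllable A B T := by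
  classical
  intro ψ₀ ψ₁ h₀ h₁
  obtain ⟨M, hM⟩ := exists_measurement_diagonalizing hn hA hAH
  have hnorm : ∀ m : Bits n, ‖M.postState m‖ = 1 := M.orthonormal_postState.1
  have key : ∀ χ : StateSpace n, ‖χ‖ = 1 → ∃ g : StateSpace n → ℝ → Fin p → ℝ,
      (∀ v, IsAdmissible (g v)) ∧ ∀ m : Bits n, ∃ q, IsSolution A B (g (M.postState m)) T
        (M.postState m) q ∧ ∃ c : ℂ, ‖c‖ = 1 ∧ q T = c • χ := by
    intro χ hχ
    -- A feedback law sees a vector and not an outcome, so a control is chosen for every vector,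
    -- with zero as default away from the post-measurement states.
    have : ∀ v : StateSpace n, ∃ u : ℝ → Fin p → ℝ, IsAdmissible u ∧ ∀ m : Bits n,
        v = M.postState m → ∃ q, IsSolution A B u T v q ∧ ∃ c : ℂ, ‖c‖ = 1 ∧ q T = c • χ := by
      intro v
      by_cases hv : ∃ m : Bits n, v = M.postState m
      · obtain ⟨m, rfl⟩ := hv
        obtain ⟨κ, hκ⟩ := hM m
        obtain ⟨u, hu, q, hq⟩ := exists_control_of_transitive hA hR htrans (hnorm m) hκ hχ
        exact ⟨u, hu, fun _ _ => ⟨q, hq⟩⟩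
      · exact ⟨fun _ _ => 0, ⟨fun _ => measurable_const, fun _ => ⟨0, fun _ _ _ => by simp⟩⟩,
          fun m hm => absurd ⟨m, hm⟩ hv⟩
    choose g hg hg' using this
    exact ⟨g, hg, fun m => hg' _ m rfl⟩
  obtain ⟨g₀, hg₀, hs₀⟩ := key (M.postState fun _ => 0) (hnorm _)
  obtain ⟨g₁, hg₁, hs₁⟩ := key ψ₁ h₁
  choose q₀ hq₀ c₀ hc₀ hqc₀ using hs₀
  choose q₁ hq₁ c₁ hc₁ hqc₁ using hs₁
  set z : Bits n := fun _ => 0 with hz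
  -- The second measurement almost surely gives `z`, so the phase attached to `z` is the only one
  -- that counts.
  obtain ⟨φ, hφ⟩ := (Complex.norm_eq_one_iff (c₁ z)).1 (hc₁ z)
  let ψ : (t : ℕ) → (Fin t → Bits n) → StateSpace n := fun t =>
    match t with
    | 0 => fun _ => ψ₀
    | 1 => fun ω => q₀ (ω (Fin.last 0)) T
    | k + 2 => fun ω => q₁ (ω (Fin.last (k + 1))) T
  refine ⟨2, two_pos, M, fun t h => if t = 0 then g₀ (h (Fin.last t)) else g₁ (h (Fin.last t)), φ,
    ?_, ψ, ⟨fun ω => rfl, ?_⟩, ?_⟩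
  · intro t h
    dsimp only
    split_ifs
    exacts [hg₀ _, hg₁ _]
  · intro t ht ω
    interval_cases t
    · exact ⟨q₀ (ω (Fin.last 0)), by simpa using hq₀ _, rfl⟩
    · exact ⟨q₁ (ω (Fin.last 1)), by simpa using hq₁ _, rfl⟩
  · have hrec : ∀ ω : Fin 2 → Bits n, recordProb M ψ 2 ω =
        M.outcomeProb ψ₀ (ω 0) * if ω 1 = z then 1 else 0 := by
      intro ω
      simp only [recordProb, one_mul]
      congr 1
      change M.outcomeProb (q₀ _ T) _ = _
      rw [hqc₀, M.outcomeProb_smul_postState (hc₀ _)]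
      rfl
    -- For `ω 1 ≠ z` the final state may or may not be the target, but such a record has probability
    -- zero.
    have hterm : ∀ ω : Fin 2 → Bits n,
        (if ψ 2 ω = Complex.exp (Complex.I * φ) • ψ₁ then recordProb M ψ 2 ω else 0) =
          M.outcomeProb ψ₀ (ω 0) * if ω 1 = z then 1 else 0 := by
      intro ω
      rw [hrec]
      by_cases h : ω 1 = z
      · have : ψ 2 ω = Complex.exp (Complex.I * φ) • ψ₁ := by
          change q₁ (ω 1) T = _
          rw [h, hqc₁, ← hφ, mul_comm]
        rw [if_pos this]
      · simp [h]
    rw [stateProb, Finset.sum_congr rfl fun ω _ => hterm ω,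
      ← (finTwoArrowEquiv (Bits n)).symm.sum_comp, Fintype.sum_prod_type]
    simp [M.sum_outcomeProb, h₀]

end Reduction
end QubitNetwork

namespace QubitNetwork

/-! ### Transitivity for `su` -/

section SU

open scoped ComplexOrder

theorem conjTranspose_vecMulVec_star {κ : Type*} (a b : κ → ℂ) :
    (vecMulVec a (star b))ᴴ = vecMulVec b (star a) := by
  rw [conjTranspose_vecMulVec, star_star]

variable {κ : Type*} [Fintype κ]

theorem vecMulVec_mulVec_eq_smul (a b v : κ → ℂ) : vecMulVec a b *ᵥ v = (b ⬝ᵥ v) • a := by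
  rw [vecMulVec_mulVec, op_smul_eq_smul]

theorem star_dotProduct_swap (a b : κ → ℂ) : star b ⬝ᵥ a = star (star a ⬝ᵥ b) := star_dotProduct b a

/-- Up to phase, two unit vectors are joined by a real rotation. -/
theorem exists_rotation {x y : κ → ℂ} (hx : star x ⬝ᵥ x = 1) (hy : star y ⬝ᵥ y = 1) :
    ∃ c : ℂ, ‖c‖ = 1 ∧ (x = c • y ∨ ∃ (θ : ℝ) (z : κ → ℂ), star z ⬝ᵥ z = 1 ∧ star x ⬝ᵥ z = 0 ∧
      (Real.cos θ : ℂ) • x + (Real.sin θ : ℂ) • z = c • y) := by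
  -- The phase is chosen to make the inner product of `x` with `c • y` a real number `r ≥ 0`. Then
  -- `c • y = r x + d` with `d` orthogonal to `x` and of squared norm `1 - r²`, so the angle is
  -- `arccos r`.
  obtain ⟨c, hc, r, hr, hcr⟩ : ∃ c : ℂ, ‖c‖ = 1 ∧ ∃ r : ℝ, 0 ≤ r ∧ c * (star x ⬝ᵥ y) = r := by
    by_cases h : star x ⬝ᵥ y = 0
    · exact ⟨1, by simp, 0, le_rfl, by simp [h]⟩
    · refine ⟨star (star x ⬝ᵥ y) / ‖star x ⬝ᵥ y‖, ?_, ‖star x ⬝ᵥ y‖, norm_nonneg _, ?_⟩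
      · rw [norm_div, norm_star]; simp [h]
      · have := Complex.conj_mul' (star x ⬝ᵥ y)
        have h2 : (‖star x ⬝ᵥ y‖ : ℂ) ≠ 0 := by simpa using h
        rw [div_mul_eq_mul_div, div_eq_iff h2, ← sq]
        exact this
  have hcc : star c * c = 1 := by
    have := Complex.conj_mul' c
    rw [hc] at this; simpa using this
  refine ⟨c, hc, ?_⟩
  obtain ⟨y', hy'⟩ : ∃ y', y' = c • y := ⟨_, rfl⟩
  rw [← hy']
  have h1 : star x ⬝ᵥ y' = r := by rw [hy', dotProduct_smul, smul_eq_mul, hcr]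
  have h1' : star y' ⬝ᵥ x = r := by rw [star_dotProduct_swap, h1]; simp
  have h2 : star y' ⬝ᵥ y' = 1 := by
    rw [hy', star_smul, smul_dotProduct, dotProduct_smul, hy, smul_eq_mul, smul_eq_mul, mul_one, hcc]
  set d := y' - (r : ℂ) • x with hd
  have h3 : star x ⬝ᵥ d = 0 := by
    rw [hd, dotProduct_sub, h1, dotProduct_smul, hx]; simp
  have h4 : star d ⬝ᵥ d = ((1 - r ^ 2 : ℝ) : ℂ) := by
    nth_rewrite 1 [hd]
    rw [star_sub, sub_dotProduct, star_smul, smul_dotProduct, h3, hd, dotProduct_sub, h2,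
      dotProduct_smul, h1']
    simp; ring
  have h5 : 0 ≤ 1 - r ^ 2 := by
    have := dotProduct_star_self_nonneg d
    rw [h4] at this
    exact_mod_cast this
  rcases h5.eq_or_lt with h6 | h6
  · left
    have hr1 : r = 1 := by nlinarith
    have hd0 : d = 0 := by
      rw [← h6] at h4
      exact dotProduct_star_self_eq_zero.1 (by simpa using h4)
    rw [hd, hr1] at hd0
    simpa using (sub_eq_zero.1 hd0).symm
  · right
    set s := Real.sqrt (1 - r ^ 2) with hs
    have hs0 : (s : ℂ) ≠ 0 := by
      have := Real.sqrt_pos.2 h6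
      exact_mod_cast this.ne'
    have hss : (s : ℂ) * s = ((1 - r ^ 2 : ℝ) : ℂ) := by
      rw [← Complex.ofReal_mul, Real.mul_self_sqrt h5]
    refine ⟨Real.arccos r, (s : ℂ)⁻¹ • d, ?_, ?_, ?_⟩
    · rw [star_smul, smul_dotProduct, dotProduct_smul, h4, ← hss]
      simp [hs0]
    · rw [dotProduct_smul, h3, smul_zero]
    · rw [Real.cos_arccos (by linarith) (by nlinarith), Real.sin_arccos, ← hs, smul_smul,
        mul_inv_cancel₀ hs0, one_smul, hd]
      abel

variable [DecidableEq κ]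

/-- An `X` acting as a quarter turn on the plane of `x` and `z` exponentiates to all rotations of
that plane, and `exists_rotation` reaches every unit vector this way up to phase. -/
theorem TransitiveUpToPhase.of_rotation {L : LieSubalgebra ℝ (Matrix κ κ ℂ)}
    (h : ∀ x z : κ → ℂ, star x ⬝ᵥ x = 1 → star z ⬝ᵥ z = 1 → star x ⬝ᵥ z = 0 →
      ∃ X ∈ L, X *ᵥ x = z ∧ X *ᵥ z = -x) : TransitiveUpToPhase L := by
  intro x y hx hy
  obtain ⟨c, hc, hxy | ⟨θ, z, hz, hxz, hr⟩⟩ := exists_rotation hx hy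
  · exact ⟨0, L.zero_mem, c, hc, by rw [NormedSpace.exp_zero, one_mulVec, hxy]⟩
  · obtain ⟨X, hX, hXx, hXz⟩ := h x z hx hz hxz
    exact ⟨θ • X, L.smul_mem θ hX, c, hc, by rw [exp_mulVec_of_rotation θ hXx hXz, hr]⟩

theorem transitiveUpToPhase_su (κ : Type) [Fintype κ] [DecidableEq κ] :
    TransitiveUpToPhase (su κ) := by
  refine .of_rotation fun x z hx hz hxz => ?_
  have hzx : star z ⬝ᵥ x = 0 := by rw [star_dotProduct_swap, hxz, star_zero]
  refine ⟨vecMulVec z (star x) - vecMulVec x (star z), ⟨?_, ?_⟩, ?_, ?_⟩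
  · rw [conjTranspose_sub, conjTranspose_vecMulVec_star, conjTranspose_vecMulVec_star, neg_sub]
  · rw [trace_sub, trace_vecMulVec, trace_vecMulVec, dotProduct_comm, hxz, dotProduct_comm, hzx,
      sub_zero]
  · rw [sub_mulVec, vecMulVec_mulVec_eq_smul, vecMulVec_mulVec_eq_smul, hx, hzx]; simp
  · rw [sub_mulVec, vecMulVec_mulVec_eq_smul, vecMulVec_mulVec_eq_smul, hz, hxz]; simp

theorem exists_eq_smul_one_of_forall_mulVec {Z : Matrix κ κ ℂ}
    (h : ∀ x, ∃ c : ℂ, Z *ᵥ x = c • x) : ∃ c : ℂ, Z = c • 1 := by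
  obtain ⟨c, hc⟩ := LinearMap.exists_eq_smul_id_of_forall_notLinearIndependent
    (f := Matrix.toLin' Z) (fun v hv => by
      obtain ⟨c, hc⟩ := h v
      rw [LinearIndependent.pair_iff] at hv
      have := (hv c (-1) (by rw [Matrix.toLin'_apply, hc]; simp)).2
      simp at this)
  refine ⟨c, Matrix.toLin'.injective ?_⟩
  rw [hc, map_smul, Matrix.toLin'_one]
  rfl

/-- Commuting with the traceless part of `i x xᴴ` means commuting with `x xᴴ`, which makes `x` an
eigenvector of `Z`. As this holds for all `x`, `Z` is scalar, and its trace vanishes. -/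
theorem eq_zero_of_forall_lie_su {κ : Type} [Fintype κ] [DecidableEq κ] {Z : Matrix κ κ ℂ}
    (hZ : Z.trace = 0) (h : ∀ Y ∈ su κ, ⁅Z, Y⁆ = 0) : Z = 0 := by
  cases isEmpty_or_nonempty κ
  · exact Subsingleton.elim _ _
  have hN : (Fintype.card κ : ℂ) ≠ 0 := by simp
  have h1 : ∀ x, ∃ c : ℂ, Z *ᵥ x = c • x := by
    intro x
    by_cases hx : x = 0
    · exact ⟨0, by simp [hx]⟩
    have hxx : star x ⬝ᵥ x ≠ 0 := fun h => hx (dotProduct_star_self_eq_zero.1 h)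
    have hreal : star (star x ⬝ᵥ x) = star x ⬝ᵥ x := (star_dotProduct_swap x x).symm
    set t : ℂ := (star x ⬝ᵥ x) / Fintype.card κ with ht
    have hts : star t = t := by rw [ht, star_div₀, hreal]; simp
    have hmem : Complex.I • (vecMulVec x (star x) - t • (1 : Matrix κ κ ℂ)) ∈ su κ := by
      refine ⟨?_, ?_⟩
      · rw [conjTranspose_smul, conjTranspose_sub, conjTranspose_vecMulVec_star,
          conjTranspose_smul, hts, conjTranspose_one]
        simp
      · rw [trace_smul, trace_sub, trace_vecMulVec, trace_smul, trace_one, ht, dotProduct_comm]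
        simp [hN]
    have h2 := h _ hmem
    rw [Ring.lie_def] at h2
    simp only [mul_smul_comm, smul_mul_assoc, mul_sub, sub_mul, mul_one, one_mul] at h2
    rw [← smul_sub, smul_eq_zero_iff_right Complex.I_ne_zero] at h2
    have h3 : Z * vecMulVec x (star x) = vecMulVec x (star x) * Z := by
      rw [← sub_eq_zero, ← h2]; abel
    have h4 := congrArg (fun Y => Y *ᵥ x) h3
    simp only [← mulVec_mulVec, vecMulVec_mulVec_eq_smul, mulVec_smul] at h4
    refine ⟨(star x ⬝ᵥ x)⁻¹ * (star x ⬝ᵥ Z *ᵥ x), ?_⟩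
    rw [mul_smul, ← h4, smul_smul, inv_mul_cancel₀ hxx, one_smul]
  obtain ⟨c, rfl⟩ := exists_eq_smul_one_of_forall_mulVec h1
  rw [trace_smul, trace_one, smul_eq_mul, mul_eq_zero] at hZ
  rw [hZ.resolve_right hN, zero_smul]

theorem finrank_su_congr {ι κ : Type} [Fintype ι] [DecidableEq ι] [Fintype κ] [DecidableEq κ]
    (e : ι ≃ κ) : Module.finrank ℝ (su ι) = Module.finrank ℝ (su κ) := by
  have : (su ι).toSubmodule.map (Matrix.reindexLinearEquiv ℝ ℂ e e).toLinearMap =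
      (su κ).toSubmodule := by
    ext X
    constructor
    · rintro ⟨Y, ⟨hY, hY'⟩, rfl⟩
      refine ⟨?_, ?_⟩
      · change (Y.submatrix e.symm e.symm)ᴴ = -(Y.submatrix e.symm e.symm)
        rw [conjTranspose_submatrix, hY]; rfl
      · change (Y.submatrix e.symm e.symm).trace = 0
        rw [trace, ← hY', trace]
        exact e.symm.sum_comp fun i => Y i i
    · rintro ⟨hX, hX'⟩
      refine ⟨X.submatrix e e, ⟨?_, ?_⟩, ?_⟩
      · rw [conjTranspose_submatrix, hX]; rfl
      · rw [trace, ← hX', trace]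
        exact e.sum_comp fun i => X i i
      · change (X.submatrix e e).submatrix e.symm e.symm = X
        simp
  have h2 := LinearEquiv.finrank_map_eq (Matrix.reindexLinearEquiv ℝ ℂ e e) (su ι).toSubmodule
  change Module.finrank ℝ (su ι).toSubmodule = Module.finrank ℝ (su κ).toSubmodule
  rw [← this]
  exact h2.symm

/-- A Lie algebra of skew-Hermitian `N × N` matrices isomorphic to `su N` acts transitively. -/
theorem transitiveUpToPhase_of_equiv_su {ι κ : Type} [Fintype ι] [DecidableEq ι] [Fintype κ]
    [DecidableEq κ] {L : LieSubalgebra ℝ (Matrix κ κ ℂ)} (hL : ∀ X ∈ L, Xᴴ = -X)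
    (e : L ≃ₗ⁅ℝ⁆ su ι) (hcard : Fintype.card ι = Fintype.card κ) : TransitiveUpToPhase L := by
  cases isEmpty_or_nonempty κ
  · intro x y hx
    simp [dotProduct] at hx
  have hN : (Fintype.card κ : ℂ) ≠ 0 := by simp
  -- Elements of `L` are not assumed traceless; `π` removes the trace part and maps `L` into `su κ`.
  let a : Matrix κ κ ℂ → ℂ := fun X => X.trace / Fintype.card κ
  let π : Matrix κ κ ℂ →ₗ[ℝ] Matrix κ κ ℂ :=
    { toFun := fun X => X - a X • 1
      map_add' := fun X Y => by
        simp only [a, trace_add, add_div, add_smul]; abel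
      map_smul' := fun c X => by
        simp only [a, trace_smul, RingHom.id_apply, smul_sub, smul_div_assoc, smul_assoc] }
  have ha : ∀ X ∈ L, star (a X) = -a X := by
    intro X hX
    have := congrArg trace (hL X hX)
    rw [trace_conjTranspose, trace_neg] at this
    simp only [a, star_div₀, this, neg_div]
    simp
  have hle : L.toSubmodule.map π ≤ (su κ).toSubmodule := by
    rintro _ ⟨X, hX, rfl⟩
    refine ⟨?_, ?_⟩
    · change (X - a X • (1 : Matrix κ κ ℂ))ᴴ = -(X - a X • (1 : Matrix κ κ ℂ))
      rw [conjTranspose_sub, conjTranspose_smul, ha X hX, hL X hX, conjTranspose_one, neg_smul]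
      abel
    · change (X - a X • (1 : Matrix κ κ ℂ)).trace = 0
      rw [trace_sub, trace_smul, trace_one]
      simp [a, hN]
  have hinj : Function.Injective (π.domRestrict L.toSubmodule) := by
    rw [← LinearMap.ker_eq_bot, LinearMap.ker_eq_bot']
    rintro ⟨X, hX⟩ h
    have hX1 : X = a X • 1 := sub_eq_zero.1 h
    -- An element killed by `π` is scalar, hence central in `L`, and its image under `e` lies in the
    -- trivial centre of `su ι`.
    have hcent : ∀ Y : L, ⁅(⟨X, hX⟩ : L), Y⁆ = 0 := by
      intro Y
      refine Subtype.ext ?_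
      change X * Y.1 - Y.1 * X = 0
      rw [hX1]; simp
    have h0 : ((e ⟨X, hX⟩ : su ι) : Matrix ι ι ℂ) = 0 := by
      refine eq_zero_of_forall_lie_su (e ⟨X, hX⟩).2.2 fun Y hY => ?_
      have h1 : ⁅e ⟨X, hX⟩, (⟨Y, hY⟩ : su ι)⁆ = 0 := by
        rw [← e.apply_symm_apply ⟨Y, hY⟩, ← LieEquiv.map_lie, hcent, map_zero]
      exact congrArg Subtype.val h1
    have h1 : e ⟨X, hX⟩ = 0 := Subtype.ext h0
    exact (map_eq_zero_iff e e.injective).1 h1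
  have hrank : Module.finrank ℝ (L.toSubmodule.map π) = Module.finrank ℝ (su κ).toSubmodule := by
    rw [← LinearMap.range_domRestrict, LinearMap.finrank_range_of_inj hinj]
    calc Module.finrank ℝ L.toSubmodule = Module.finrank ℝ (su ι) := e.toLinearEquiv.finrank_eq
      _ = _ := finrank_su_congr (Fintype.equivOfCardEq hcard)
  have heq := Submodule.eq_of_le_of_finrank_eq hle hrank
  intro x y hx hy
  obtain ⟨Y, hY, c, hc, hYc⟩ := transitiveUpToPhase_su κ x y hx hy
  obtain ⟨X, hX, hXY⟩ : Y ∈ L.toSubmodule.map π := by rw [heq]; exact hY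
  -- `X` and its traceless part `Y` differ by an imaginary scalar, so their exponentials differ by a
  -- phase.
  have hsum : X = Y + a X • (1 : Matrix κ κ ℂ) := by
    rw [← hXY]
    change X = X - a X • 1 + a X • 1
    abel
  refine ⟨X, hX, Complex.exp (a X) * c, ?_, ?_⟩
  · have h1 := congrArg Complex.re (ha X hX)
    simp only [Complex.star_def, Complex.conj_re, Complex.neg_re] at h1
    rw [norm_mul, hc, Complex.norm_exp, show (a X).re = 0 by linarith]
    simp
  · have h1 := exp_mulVec_of_mulVec_eq_smul (A := a X • (1 : Matrix κ κ ℂ)) (v := y) (c := a X)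
      (by rw [smul_mulVec, one_mulVec])
    generalize a X = t at *
    rw [hsum, add_comm, Matrix.exp_add_of_commute _ _ ((Commute.one_left Y).smul_left _),
      ← mulVec_mulVec, hYc, mulVec_smul, h1, smul_smul, mul_comm]

end SU
end QubitNetwork

namespace QubitNetwork

/-! ### Transitivity for `sp` -/

section SP

variable {m : ℕ}

theorem sympJ_mul_self (m : ℕ) : sympJ m * sympJ m = -1 := by
  rw [sympJ, fromBlocks_multiply, ← fromBlocks_one, fromBlocks_neg]
  simp

theorem sympJ_transpose (m : ℕ) : (sympJ m)ᵀ = -sympJ m := by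
  rw [sympJ, fromBlocks_transpose, fromBlocks_neg]
  simp

theorem sympJ_conjTranspose (m : ℕ) : (sympJ m)ᴴ = -sympJ m := by
  rw [sympJ, fromBlocks_conjTranspose, fromBlocks_neg]
  simp

/-- The quaternionic structure of `ℂ^(2m)`. -/
noncomputable def quatJ (x : Fin m ⊕ Fin m → ℂ) : Fin m ⊕ Fin m → ℂ := sympJ m *ᵥ star x

theorem quatJ_quatJ (x : Fin m ⊕ Fin m → ℂ) : quatJ (quatJ x) = -x := by
  have h : star (sympJ m *ᵥ star x) = sympJ m *ᵥ x := by
    rw [star_mulVec, star_star, sympJ_conjTranspose, ← mulVec_transpose, transpose_neg,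
      sympJ_transpose, neg_neg]
  rw [quatJ, quatJ, h, mulVec_mulVec, sympJ_mul_self, neg_mulVec, one_mulVec]

theorem quatJ_add (x y : Fin m ⊕ Fin m → ℂ) : quatJ (x + y) = quatJ x + quatJ y := by
  rw [quatJ, star_add, mulVec_add]; rfl

theorem quatJ_smul (c : ℂ) (x : Fin m ⊕ Fin m → ℂ) : quatJ (c • x) = star c • quatJ x := by
  rw [quatJ, star_smul, mulVec_smul]; rfl

theorem star_quatJ_dotProduct (a v : Fin m ⊕ Fin m → ℂ) :
    star (quatJ a) ⬝ᵥ v = -(a ⬝ᵥ (sympJ m *ᵥ v)) := by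
  rw [quatJ, star_mulVec_dotProduct, star_star, sympJ_conjTranspose, neg_mulVec, dotProduct_neg]

/-- Up to sign this pairing is the complex bilinear form with matrix `sympJ m`, which is
alternating. -/
theorem star_quatJ_dotProduct_swap (a b : Fin m ⊕ Fin m → ℂ) :
    star (quatJ a) ⬝ᵥ b = -(star (quatJ b) ⬝ᵥ a) := by
  rw [star_quatJ_dotProduct, star_quatJ_dotProduct, dotProduct_mulVec, ← mulVec_transpose,
    sympJ_transpose, neg_mulVec, neg_dotProduct, dotProduct_comm]

theorem star_quatJ_dotProduct_self (a : Fin m ⊕ Fin m → ℂ) : star (quatJ a) ⬝ᵥ a = 0 :=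
  self_eq_neg.1 (star_quatJ_dotProduct_swap a a)

/-- The projection of a skew-Hermitian matrix to `sp`. -/
theorem add_conj_mem_sp {M : Matrix (Fin m ⊕ Fin m) (Fin m ⊕ Fin m) ℂ} (hM : Mᴴ = -M) :
    M + sympJ m * Mᵀ * sympJ m ∈ sp m := by
  have hMT : (Mᵀ)ᴴ = -Mᵀ := by
    rw [← transpose_neg, ← hM]
    rfl
  refine ⟨⟨?_, ?_⟩, ?_⟩
  · rw [conjTranspose_add, conjTranspose_mul, conjTranspose_mul, hM, hMT, sympJ_conjTranspose]
    noncomm_ring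
  · rw [trace_add, mul_assoc, trace_mul_comm, mul_assoc, sympJ_mul_self, mul_neg, mul_one,
      trace_neg, trace_transpose, add_neg_cancel]
  · rw [transpose_add, transpose_mul, transpose_mul, transpose_transpose, sympJ_transpose, add_mul,
      mul_assoc _ (sympJ m) (sympJ m), sympJ_mul_self, mul_add]
    have : sympJ m * (-sympJ m * (M * -sympJ m)) = -(M * sympJ m) := by
      rw [mul_neg M, neg_mul_neg, ← mul_assoc, sympJ_mul_self]
      simp
    rw [this]
    noncomm_ring

/-- The element of `sp` attached to two vectors. -/
noncomputable def spPair (a b : Fin m ⊕ Fin m → ℂ) : Matrix (Fin m ⊕ Fin m) (Fin m ⊕ Fin m) ℂ :=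
  (vecMulVec a (star b) - vecMulVec b (star a)) +
    sympJ m * (vecMulVec a (star b) - vecMulVec b (star a))ᵀ * sympJ m

theorem spPair_mem (a b : Fin m ⊕ Fin m → ℂ) : spPair a b ∈ sp m :=
  add_conj_mem_sp (by
    rw [conjTranspose_sub, conjTranspose_vecMulVec_star, conjTranspose_vecMulVec_star, neg_sub])

theorem spPair_mulVec (a b v : Fin m ⊕ Fin m → ℂ) :
    spPair a b *ᵥ v = (star b ⬝ᵥ v) • a - (star a ⬝ᵥ v) • b +
      ((star (quatJ b) ⬝ᵥ v) • quatJ a - (star (quatJ a) ⬝ᵥ v) • quatJ b) := by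
  rw [spPair, add_mulVec, sub_mulVec, vecMulVec_mulVec_eq_smul, vecMulVec_mulVec_eq_smul,
    transpose_sub, transpose_vecMulVec, transpose_vecMulVec, ← mulVec_mulVec, ← mulVec_mulVec,
    sub_mulVec, vecMulVec_mulVec_eq_smul, vecMulVec_mulVec_eq_smul, mulVec_sub, mulVec_smul,
    mulVec_smul, star_quatJ_dotProduct, star_quatJ_dotProduct]
  simp only [quatJ]
  module

/-- Split `z = e + β Jx`, where `e` is orthogonal to `x` and to `Jx`. Both parts are produced from
`x` by elements `spPair _ x`; a second `spPair`, which kills `x`, corrects the value at `z`. -/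
theorem exists_mem_sp_rotation {x z : Fin m ⊕ Fin m → ℂ} (hx : star x ⬝ᵥ x = 1)
    (hz : star z ⬝ᵥ z = 1) (hxz : star x ⬝ᵥ z = 0) :
    ∃ X ∈ sp m, X *ᵥ x = z ∧ X *ᵥ z = -x := by
  obtain ⟨β, hβ⟩ : ∃ β, β = star (quatJ x) ⬝ᵥ z := ⟨_, rfl⟩
  obtain ⟨e, he⟩ : ∃ e, e = z - β • quatJ x := ⟨_, rfl⟩
  have hze : z = e + β • quatJ x := by rw [he]; abel
  have hxJ : star (quatJ x) ⬝ᵥ x = 0 := star_quatJ_dotProduct_self x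
  have hxJ' : star x ⬝ᵥ quatJ x = 0 := by rw [star_dotProduct_swap, hxJ, star_zero]
  have hJJ : star (quatJ x) ⬝ᵥ quatJ x = 1 := by
    rw [star_quatJ_dotProduct_swap, quatJ_quatJ, star_neg, neg_dotProduct, hx, neg_neg]
  have hxe : star x ⬝ᵥ e = 0 := by
    rw [he, dotProduct_sub, dotProduct_smul, hxz, hxJ']; simp
  have hex : star e ⬝ᵥ x = 0 := by rw [star_dotProduct_swap, hxe, star_zero]
  have hJxe : star (quatJ x) ⬝ᵥ e = 0 := by
    rw [he, dotProduct_sub, dotProduct_smul, hJJ, ← hβ]; simp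
  have heJx : star e ⬝ᵥ quatJ x = 0 := by rw [star_dotProduct_swap, hJxe, star_zero]
  have hJex : star (quatJ e) ⬝ᵥ x = 0 := by rw [star_quatJ_dotProduct_swap, hJxe, neg_zero]
  have hJee : star (quatJ e) ⬝ᵥ e = 0 := star_quatJ_dotProduct_self e
  have hJeJx : star (quatJ e) ⬝ᵥ quatJ x = 0 := by
    rw [star_quatJ_dotProduct_swap, quatJ_quatJ, star_neg, neg_dotProduct, hxe, neg_neg]
  obtain ⟨ρ, hρ⟩ : ∃ ρ, ρ = star e ⬝ᵥ e := ⟨_, rfl⟩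
  have hρβ : ρ + star β * β = 1 := by
    rw [← hz, hze]
    simp only [star_add, add_dotProduct, star_smul, smul_dotProduct, dotProduct_add,
      dotProduct_smul, ← hρ, heJx, hJxe, hJJ, smul_eq_mul]
    ring
  have hρ' : ((ρ.re : ℝ) : ℂ) = ρ := by
    rw [← Complex.conj_eq_iff_re, hρ]
    exact (star_dotProduct_swap e e).symm
  -- When `ρ = 0` the vector `e` vanishes, so the convention `0⁻¹ = 0` does no harm.
  have hρe : (ρ⁻¹ * ρ) • quatJ e = quatJ e := by
    by_cases h : ρ = 0
    · have : e = 0 := by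
        open scoped ComplexOrder in
        exact dotProduct_star_self_eq_zero.1 (hρ.symm.trans h)
      simp [this, quatJ]
    · rw [inv_mul_cancel₀ h, one_smul]
  -- The coefficient is `β / 2` because the symplectic conjugate part of `spPair` yields another `(β
  -- / 2) Jx`. The first term sends `z` to `-x + β Je`; since `spPair (β Je) e` sends `z` to `2 ρ β
  -- Je`, the second term removes the excess.
  refine ⟨spPair (e + (β / 2) • quatJ x) x - (2 * ρ.re)⁻¹ • spPair (β • quatJ e) e,
    (sp m).sub_mem (spPair_mem _ _) ((sp m).smul_mem _ (spPair_mem _ _)), ?_, ?_⟩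
  · rw [sub_mulVec, smul_mulVec, spPair_mulVec, spPair_mulVec, quatJ_add, quatJ_smul, quatJ_smul,
      quatJ_quatJ, quatJ_quatJ]
    simp only [star_add, add_dotProduct, star_smul, smul_dotProduct, star_neg, neg_dotProduct, hx,
      hex, hxJ, hJex, hze, smul_eq_mul]
    simp only [star_star, mul_zero, zero_smul, smul_zero, sub_zero, zero_sub, neg_zero, add_zero,
      zero_add, one_smul]
    module
  · rw [sub_mulVec, smul_mulVec, spPair_mulVec, spPair_mulVec, quatJ_add, quatJ_smul, quatJ_smul,
      quatJ_quatJ, quatJ_quatJ, ← Complex.coe_smul]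
    simp only [star_add, add_dotProduct, star_smul, smul_dotProduct, star_neg, neg_dotProduct,
      hze, dotProduct_add, dotProduct_smul, hJxe, hxe, heJx, hJee, hJeJx,
      hJJ, hxJ', ← hρ, smul_eq_mul]
    simp only [star_star, mul_zero, zero_smul, sub_zero, zero_sub, neg_zero, add_zero,
      zero_add, mul_one]
    push_cast
    rw [hρ']
    have h1 : ρ + 2 * (β * star (β / 2)) = 1 := by
      rw [← hρβ, star_div₀, star_ofNat]; ring
    rw [mul_inv]
    funext k
    have h2 : ρ⁻¹ * ρ * quatJ e k = quatJ e k := congrFun hρe k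
    simp only [Pi.add_apply, Pi.sub_apply, Pi.neg_apply, Pi.smul_apply, smul_eq_mul]
    linear_combination (-x k) * h1 - β * h2

open scoped ComplexOrder in
/-- A Lie algebra that is unitarily equivalent, up to scaling, to `sp` acts transitively. -/
theorem transitiveUpToPhase_of_intertwiner {κ : Type*} [Fintype κ] [DecidableEq κ]
    {L : LieSubalgebra ℝ (Matrix κ κ ℂ)} {f : Matrix (Fin m ⊕ Fin m) (Fin m ⊕ Fin m) ℂ → Matrix κ κ ℂ}
    (hf : ∀ X ∈ sp m, f X ∈ L) {Φ : Matrix κ (Fin m ⊕ Fin m) ℂ} {Ψ : Matrix (Fin m ⊕ Fin m) κ ℂ}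
    (hΦΨ : Φ * Ψ = 1) {c : ℂ} (hΦ : Φᴴ * Φ = c • 1) (hfΦ : ∀ X ∈ sp m, f X * Φ = Φ * X) :
    TransitiveUpToPhase L := by
  have hdot : ∀ x y : κ → ℂ, star x ⬝ᵥ y = c * (star (Ψ *ᵥ x) ⬝ᵥ (Ψ *ᵥ y)) := by
    intro x y
    have h1 : ∀ x : κ → ℂ, Φ *ᵥ (Ψ *ᵥ x) = x := fun x => by rw [mulVec_mulVec, hΦΨ, one_mulVec]
    conv_lhs => rw [← h1 x, ← h1 y]
    rw [star_mulVec, ← dotProduct_mulVec, mulVec_mulVec _ Φᴴ Φ, hΦ, smul_mulVec, one_mulVec,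
      dotProduct_smul, smul_eq_mul]
  refine .of_rotation fun x z hx hz hxz => ?_
  rw [hdot] at hx hz hxz
  have hc0 : c ≠ 0 := by rintro rfl; simp at hx
  -- The scalar `c` is positive, and `g = √c` turns `Ψ` into an isometry.
  obtain ⟨g, hg⟩ : ∃ g : ℂ, star g * g = c := by
    have h1 : 0 ≤ c := by
      have h2 := dotProduct_star_self_nonneg (Ψ *ᵥ x)
      rw [eq_inv_of_mul_eq_one_right hx, ] at h2
      exact inv_nonneg.1 h2
    obtain ⟨r, hr, rfl⟩ := RCLike.nonneg_iff_exists_ofReal.1 h1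
    refine ⟨(Real.sqrt r : ℝ), ?_⟩
    have := Real.mul_self_sqrt hr
    rw [Complex.star_def, Complex.conj_ofReal, ← Complex.ofReal_mul, this]
    rfl
  have hg0 : g ≠ 0 := by rintro rfl; simp at hg; exact hc0 hg.symm
  have hnorm : ∀ x y : κ → ℂ, star (g • (Ψ *ᵥ x)) ⬝ᵥ (g • (Ψ *ᵥ y)) =
      c * (star (Ψ *ᵥ x) ⬝ᵥ (Ψ *ᵥ y)) := by
    intro x y
    rw [star_smul, smul_dotProduct, dotProduct_smul, smul_smul, hg, smul_eq_mul]
  obtain ⟨X, hX, hX1, hX2⟩ := exists_mem_sp_rotation (x := g • (Ψ *ᵥ x)) (z := g • (Ψ *ᵥ z))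
    (by rw [hnorm, hx]) (by rw [hnorm, hz]) (by rw [hnorm, hxz])
  have hback : ∀ x y : κ → ℂ, X *ᵥ (g • (Ψ *ᵥ x)) = g • (Ψ *ᵥ y) → f X *ᵥ x = y := by
    intro x y h
    rw [mulVec_smul] at h
    have h1 := smul_right_injective _ hg0 h
    calc f X *ᵥ x = (f X * Φ * Ψ) *ᵥ x := by
          rw [Matrix.mul_assoc, hΦΨ, Matrix.mul_one]
      _ = y := by
        rw [hfΦ X hX, Matrix.mul_assoc, ← mulVec_mulVec, ← mulVec_mulVec, h1, mulVec_mulVec, hΦΨ,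
          one_mulVec]
  refine ⟨f X, hf X hX, hback x z hX1, hback z (-x) ?_⟩
  rw [hX2, mulVec_neg, smul_neg]

/-- For `2 × 2` matrices `X J + J Xᵀ = (tr X) J`. -/
theorem su_le_sp_one : ∀ X ∈ su (Fin 1 ⊕ Fin 1), X ∈ sp 1 := by
  rintro X ⟨hX, hX'⟩
  refine ⟨⟨hX, hX'⟩, ?_⟩
  have h : X (Sum.inl 0) (Sum.inl 0) + X (Sum.inr 0) (Sum.inr 0) = 0 := by
    simpa [trace] using hX'
  ext i j
  rcases i with i | i <;> rcases j with j | j <;> fin_cases i <;> fin_cases j <;>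
    simp [sympJ, Matrix.mul_apply, fromBlocks_apply₁₁, fromBlocks_apply₁₂, fromBlocks_apply₂₁,
      fromBlocks_apply₂₂]
  · linear_combination h
  · linear_combination -h

end SP
end QubitNetwork

namespace QubitNetwork

/-! ### Weights for the symplectic root system -/

section Weights

variable {m : ℕ}

/-- The weights `±ε_a` of the standard representation of `sp`. -/
def stdWeight : Fin m ⊕ Fin m → Fin m → ℤ :=
  Sum.elim (fun a => Pi.single a 1) fun a => -Pi.single a 1

theorem stdWeight_swap (i : Fin m ⊕ Fin m) : stdWeight i.swap = -stdWeight i := by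
  rcases i with i | i <;> simp [stdWeight]

theorem stdWeight_dotProduct (i j : Fin m ⊕ Fin m) :
    stdWeight i ⬝ᵥ stdWeight j = (if i = j then 1 else 0) - if i = j.swap then 1 else 0 := by
  rcases i with i | i <;> rcases j with j | j <;>
    simp [stdWeight, Pi.single_apply, eq_comm]

theorem stdWeight_dotProduct_self (i : Fin m ⊕ Fin m) : stdWeight i ⬝ᵥ stdWeight i = 1 := by
  rw [stdWeight_dotProduct]
  rcases i with i | i <;> simp

theorem stdWeight_injective : Function.Injective (stdWeight (m := m)) := by
  intro i j h
  have h1 := stdWeight_dotProduct_self i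
  nth_rewrite 2 [h] at h1
  rw [stdWeight_dotProduct] at h1
  split_ifs at h1 <;> simp_all

theorem exists_stdWeight_dotProduct_pos {μ : Fin m → ℤ} (hμ : μ ≠ 0) :
    ∃ i, 0 < stdWeight i ⬝ᵥ μ := by
  obtain ⟨a, ha⟩ := Function.ne_iff.1 hμ
  rcases lt_or_gt_of_ne ha with h | h
  · exact ⟨Sum.inr a, by simpa [stdWeight] using h⟩
  · exact ⟨Sum.inl a, by simpa [stdWeight] using h⟩

/-- Without an opposite pair, pairing the sum with each of its three summands gives at least `1`.
This forces all three to equal `stdWeight t`, and the sum would be three times it. -/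
theorem eq_stdWeight_of_sum_eq {i j k t : Fin m ⊕ Fin m}
    (h : stdWeight i + stdWeight j + stdWeight k = stdWeight t) :
    j = i.swap ∨ j = k.swap ∨ i = k.swap := by
  by_contra! hc
  obtain ⟨h1, h2, h3⟩ := hc
  have h1' : i ≠ j.swap := fun h => h1 (by rw [h, Sum.swap_swap])
  have h2' : k ≠ j.swap := fun h => h2 (by rw [h, Sum.swap_swap])
  have h3' : k ≠ i.swap := fun h => h3 (by rw [h, Sum.swap_swap])
  have e1 := congrArg (fun μ => stdWeight i ⬝ᵥ μ) h
  have e2 := congrArg (fun μ => stdWeight j ⬝ᵥ μ) h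
  have e3 := congrArg (fun μ => stdWeight k ⬝ᵥ μ) h
  simp only [dotProduct_add, stdWeight_dotProduct_self] at e1 e2 e3
  simp only [stdWeight_dotProduct, if_neg h1, if_neg h2, if_neg h3, if_neg h1', if_neg h2',
    if_neg h3', sub_zero] at e1 e2 e3
  have hit : i = t := by by_contra hne; rw [if_neg hne] at e1; split_ifs at e1 <;> omega
  have hjt : j = t := by by_contra hne; rw [if_neg hne] at e2; split_ifs at e2 <;> omega
  have hkt : k = t := by by_contra hne; rw [if_neg hne] at e3; split_ifs at e3 <;> omega
  subst hit hjt hkt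
  simp at e1
  split_ifs at e1 <;> omega

/-- A finite set of integral weights that is closed under moving towards the root hyperplanes and
has at most `2 m` elements consists of the weights of the standard representation. -/
theorem eq_range_stdWeight (hm : 2 ≤ m) {K : Set (Fin m → ℤ)} (h0 : ∃ μ ∈ K, μ ≠ 0)
    (hK : ∀ μ ∈ K, ∀ i j, 0 < stdWeight i ⬝ᵥ μ + stdWeight j ⬝ᵥ μ →
      μ - stdWeight i - stdWeight j ∈ K)
    (hcard : ∀ (τ : Type) [Fintype τ] (g : τ → Fin m → ℤ), Function.Injective g →
      (∀ t, g t ∈ K) → Fintype.card τ ≤ 2 * m) : K = Set.range stdWeight := by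
  classical
  -- no two orthogonal weights of the standard representation have their sum in `K`
  have key : ∀ i j : Fin m ⊕ Fin m, j ≠ i → j ≠ i.swap → stdWeight i + stdWeight j ∉ K := by
    intro i j hji hji' hmem
    have hij : stdWeight i ⬝ᵥ stdWeight j = 0 := by
      rw [stdWeight_dotProduct, if_neg hji.symm,
        if_neg fun h => hji' (by rw [h, Sum.swap_swap]), sub_zero]
    have hij' : stdWeight j ⬝ᵥ stdWeight i = 0 := by rw [dotProduct_comm, hij]
    have hzero : (0 : Fin m → ℤ) ∈ K := by
      have := hK _ hmem i j (by
        simp [dotProduct_add, stdWeight_dotProduct_self, hij, hij'])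
      simpa using this
    have hplus : ∀ t, t ≠ i → t ≠ i.swap → stdWeight i + stdWeight t ∈ K := by
      intro t hti hti'
      by_cases htj : t = j
      · rwa [htj]
      have h1 : stdWeight t.swap ⬝ᵥ stdWeight i = 0 := by
        rw [stdWeight_swap, neg_dotProduct, stdWeight_dotProduct, if_neg hti, if_neg hti']
        simp
      have h2 : 0 ≤ stdWeight t.swap ⬝ᵥ stdWeight j := by
        rw [stdWeight_swap, neg_dotProduct, stdWeight_dotProduct, if_neg htj]
        split_ifs <;> simp
      have := hK _ hmem j t.swap (by
        rw [dotProduct_add, dotProduct_add, stdWeight_dotProduct_self, hij', h1]; omega)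
      rw [stdWeight_swap] at this
      convert this using 1
      abel
    have hminus : ∀ t, t ≠ i → t ≠ i.swap → -stdWeight i + stdWeight t ∈ K := by
      intro t hti hti'
      have h1 : stdWeight i ⬝ᵥ stdWeight t = 0 := by
        rw [dotProduct_comm, stdWeight_dotProduct, if_neg hti, if_neg hti', sub_zero]
      have := hK _ (hplus t hti hti') i i (by
        rw [dotProduct_add, stdWeight_dotProduct_self, h1]; omega)
      convert this using 1
      abel
    -- Zero and the vectors `±ε_i + ε_t` are `1 + 2 (2m - 2) = 4m - 3` elements of `K`, more than
    -- `2m` as `m ≥ 2`.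
    let τ := Option (Bool × {t : Fin m ⊕ Fin m // t ≠ i ∧ t ≠ i.swap})
    let g : τ → Fin m → ℤ := fun o => o.elim 0 fun x =>
      (if x.1 then stdWeight i else -stdWeight i) + stdWeight x.2.1
    have hg : ∀ x : Bool × {t : Fin m ⊕ Fin m // t ≠ i ∧ t ≠ i.swap},
        stdWeight i ⬝ᵥ g (some x) = if x.1 then 1 else -1 := by
      rintro ⟨b, t, ht1, ht2⟩
      have h1 : stdWeight i ⬝ᵥ stdWeight t = 0 := by
        rw [dotProduct_comm, stdWeight_dotProduct, if_neg ht1, if_neg ht2, sub_zero]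
      cases b <;> simp [g, dotProduct_add, h1, stdWeight_dotProduct_self]
    have hginj : Function.Injective g := by
      rintro (_ | x) (_ | y) hxy
      · rfl
      · have h1 := hg y
        rw [← hxy] at h1
        simp only [g, Option.elim, dotProduct_zero] at h1
        split_ifs at h1; all_goals omega
      · have h1 := hg x
        rw [hxy] at h1
        simp only [g, Option.elim, dotProduct_zero] at h1
        split_ifs at h1; all_goals omega
      · have h1 := hg x
        rw [hxy, hg y] at h1
        have h2 : x.1 = y.1 := by
          cases hx : x.1 <;> cases hy : y.1 <;> simp_all
        have h3 : x.2.1 = y.2.1 := by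
          simp only [g, Option.elim, h2] at hxy
          exact stdWeight_injective (add_left_cancel hxy)
        rw [Prod.ext h2 (Subtype.ext h3)]
    have hτ := hcard τ g hginj (by
      rintro (_ | ⟨b, t, ht1, ht2⟩)
      · exact hzero
      · cases b
        · simpa [g] using hminus t ht1 ht2
        · simpa [g] using hplus t ht1 ht2)
    have h1 : Fintype.card {t : Fin m ⊕ Fin m // t ≠ i ∧ t ≠ i.swap} = 2 * m - 2 := by
      have h2 : i ≠ i.swap := by rcases i with i | i <;> simp
      rw [Fintype.card_subtype]
      have h3 : (Finset.univ.filter fun t : Fin m ⊕ Fin m => t ≠ i ∧ t ≠ i.swap) =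
          ({i, i.swap} : Finset (Fin m ⊕ Fin m))ᶜ := by
        ext t; simp
      rw [h3, Finset.card_compl, Finset.card_pair h2]
      simp; omega
    simp only [τ, Fintype.card_option, Fintype.card_prod, Fintype.card_bool, h1] at hτ
    omega
  -- A shortest nonzero element of `K`: any permitted move that shortens it must end at zero.
  obtain ⟨μ, ⟨hμK, hμ0⟩, hmin⟩ := (measure fun μ : Fin m → ℤ => (μ ⬝ᵥ μ).natAbs).wf.has_min
    {μ | μ ∈ K ∧ μ ≠ 0} h0
  have hmin' : ∀ ν ∈ K, ν ⬝ᵥ ν < μ ⬝ᵥ μ → ν = 0 := by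
    intro ν hν hlt
    by_contra hne
    refine hmin ν ⟨hν, hne⟩ ?_
    have h1 : 0 ≤ ν ⬝ᵥ ν := Finset.sum_nonneg fun a _ => mul_self_nonneg _
    change (ν ⬝ᵥ ν).natAbs < (μ ⬝ᵥ μ).natAbs
    omega
  have hnorm : ∀ i j, (μ - stdWeight i - stdWeight j) ⬝ᵥ (μ - stdWeight i - stdWeight j) =
      μ ⬝ᵥ μ - 2 * (stdWeight i ⬝ᵥ μ) - 2 * (stdWeight j ⬝ᵥ μ) + 2 +
        2 * (stdWeight i ⬝ᵥ stdWeight j) := by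
    intro i j
    have h1 := dotProduct_comm μ (stdWeight i)
    have h2 := dotProduct_comm μ (stdWeight j)
    have h3 := dotProduct_comm (stdWeight j) (stdWeight i)
    simp only [dotProduct_sub, sub_dotProduct, stdWeight_dotProduct_self]
    rw [h1, h2, h3]
    ring
  have hle : ∀ i j : Fin m ⊕ Fin m, i ≠ j → stdWeight i ⬝ᵥ stdWeight j ≤ 0 := by
    intro i j hij
    rw [stdWeight_dotProduct, if_neg hij]
    split_ifs <;> simp
  obtain ⟨i, hi⟩ := exists_stdWeight_dotProduct_pos hμ0
  have hstd : ∃ i, stdWeight i ∈ K := by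
    -- A pairing of at least `2` forces `μ = 2 ε_i`, and one more move to `ε_i - ε_k` contradicts
    -- `key`.
    by_cases h2 : 2 ≤ stdWeight i ⬝ᵥ μ
    · exfalso
      have h3 := hmin' _ (hK μ hμK i i (by omega)) (by
        rw [hnorm, stdWeight_dotProduct_self]; omega)
      have h4 : μ = stdWeight i + stdWeight i := by
        rw [sub_sub, sub_eq_zero] at h3; exact h3
      obtain ⟨k, hk1, hk2⟩ : ∃ k : Fin m ⊕ Fin m, k ≠ i ∧ k ≠ i.swap := by
        by_contra! hc
        have h5 : (Finset.univ : Finset (Fin m ⊕ Fin m)) ⊆ {i, i.swap} := by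
          intro k _
          by_cases hk : k = i
          · simp [hk]
          · simp [hc k hk]
        have h6 := (Finset.card_le_card h5).trans Finset.card_le_two
        simp at h6
        omega
      have h5 : stdWeight k ⬝ᵥ stdWeight i = 0 := by
        rw [stdWeight_dotProduct, if_neg hk1, if_neg hk2, sub_zero]
      have h6 := hK μ hμK i k (by
        rw [h4, dotProduct_add, dotProduct_add, stdWeight_dotProduct_self, h5]; omega)
      refine key i k.swap (fun h => hk2 (by rw [← h, Sum.swap_swap]))
        (fun h => hk1 (by rw [← Sum.swap_swap k, h, Sum.swap_swap])) ?_
      rw [stdWeight_swap]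
      convert h6 using 1
      rw [h4]; abel
    · refine ⟨i, ?_⟩
      suffices h : μ = stdWeight i by rwa [← h]
      by_contra hne
      -- This `ε_j` is orthogonal to `ε_i` and pairs positively with `μ`, so `μ - ε_i - ε_j` is
      -- shorter, hence zero; again `key` excludes it.
      obtain ⟨j, hj⟩ := exists_stdWeight_dotProduct_pos (sub_ne_zero.2 hne)
      rw [dotProduct_sub] at hj
      have hi1 : stdWeight i ⬝ᵥ μ = 1 := by omega
      have hji : j ≠ i := by
        rintro rfl
        rw [hi1, stdWeight_dotProduct_self] at hj
        omega
      have hji' : j ≠ i.swap := by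
        rintro rfl
        rw [stdWeight_swap, neg_dotProduct, neg_dotProduct, hi1, stdWeight_dotProduct_self] at hj
        omega
      have h5 : stdWeight j ⬝ᵥ stdWeight i = 0 := by
        rw [stdWeight_dotProduct, if_neg hji, if_neg hji', sub_zero]
      rw [h5] at hj
      have h3 := hmin' _ (hK μ hμK i j (by omega)) (by
        have := hle i j hji.symm
        rw [hnorm]; omega)
      have h4 : μ = stdWeight i + stdWeight j := by
        rw [sub_sub, sub_eq_zero] at h3; exact h3
      exact key i j hji hji' (h4 ▸ hμK)
  obtain ⟨i, hi⟩ := hstd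
  have hall : ∀ t, stdWeight t ∈ K := by
    intro t
    by_cases hti : t = i
    · rwa [hti]
    · have h1 : 0 ≤ stdWeight t.swap ⬝ᵥ stdWeight i := by
        rw [stdWeight_swap, neg_dotProduct, stdWeight_dotProduct, if_neg hti]
        split_ifs <;> simp
      have := hK _ hi i t.swap (by rw [stdWeight_dotProduct_self]; omega)
      rw [stdWeight_swap] at this
      convert this using 1
      abel
  refine Set.Subset.antisymm (fun ν hν => ?_) (by rintro _ ⟨t, rfl⟩; exact hall t)
  by_contra hne
  -- The `2m` standard weights already exhaust the bound, leaving no room for `ν`.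
  have := hcard (Option (Fin m ⊕ Fin m)) (fun o => o.elim ν stdWeight) (by
    rintro (_ | s) (_ | t) h
    · rfl
    · exact absurd ⟨t, h.symm⟩ hne
    · exact absurd ⟨s, h⟩ hne
    · rw [stdWeight_injective h]) (by
    rintro (_ | s)
    exacts [hν, hall s])
  simp at this
  omega

end Weights
end QubitNetwork

namespace QubitNetwork

/-! ### The complex symplectic Lie algebra -/

section ComplexSp

variable {m : ℕ}

/-- Membership in the complex symplectic Lie algebra. -/
def IsSymp (X : Matrix (Fin m ⊕ Fin m) (Fin m ⊕ Fin m) ℂ) : Prop :=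
  X * sympJ m + sympJ m * Xᵀ = 0

theorem IsSymp.conjTranspose {X : Matrix (Fin m ⊕ Fin m) (Fin m ⊕ Fin m) ℂ} (hX : IsSymp X) :
    IsSymp Xᴴ := by
  have h1 := congrArg Matrix.transpose (congrArg Matrix.conjTranspose hX)
  rw [conjTranspose_add, conjTranspose_mul, conjTranspose_mul, sympJ_conjTranspose, transpose_add,
    transpose_mul, transpose_mul, transpose_neg, sympJ_transpose, neg_neg] at h1
  unfold IsSymp
  have h3 : sympJ m * (Xᴴ * sympJ m + sympJ m * Xᴴᵀ) * sympJ m = 0 := by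
    have h4 : sympJ m * (Xᴴ * sympJ m + sympJ m * Xᴴᵀ) * sympJ m =
        sympJ m * Xᴴ * (sympJ m * sympJ m) + (sympJ m * sympJ m) * Xᴴᵀ * sympJ m := by
      noncomm_ring
    rw [h4, sympJ_mul_self, mul_neg_one, neg_one_mul]
    have h5 : Xᴴᵀ * sympJ m + sympJ m * Xᴴ = 0 := by
      simpa [show Xᵀᴴᵀ = Xᴴ from rfl] using h1
    rw [neg_mul, ← neg_add, add_comm, h5, neg_zero]
  have h6 := congrArg (fun Y => sympJ m * Y * sympJ m) h3
  simp only [← mul_assoc, sympJ_mul_self] at h6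
  simpa [mul_assoc, sympJ_mul_self] using h6

theorem IsSymp.trace_eq_zero {X : Matrix (Fin m ⊕ Fin m) (Fin m ⊕ Fin m) ℂ} (hX : IsSymp X) :
    X.trace = 0 := by
  have h1 : X = sympJ m * Xᵀ * sympJ m := by
    have := congrArg (fun Y => Y * sympJ m) hX
    simp only [add_mul, mul_assoc X, sympJ_mul_self, mul_neg_one, zero_mul] at this
    exact (neg_add_eq_zero.1 this)
  have h2 := congrArg trace h1
  rw [mul_assoc, trace_mul_comm, mul_assoc, sympJ_mul_self, mul_neg_one, trace_neg,
    trace_transpose] at h2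
  exact self_eq_neg.1 h2

theorem IsSymp.add {X Y : Matrix (Fin m ⊕ Fin m) (Fin m ⊕ Fin m) ℂ} (hX : IsSymp X)
    (hY : IsSymp Y) : IsSymp (X + Y) := by
  unfold IsSymp at *
  rw [transpose_add, add_mul, mul_add, add_add_add_comm, hX, hY, add_zero]

theorem IsSymp.smul {X : Matrix (Fin m ⊕ Fin m) (Fin m ⊕ Fin m) ℂ} (c : ℂ) (hX : IsSymp X) :
    IsSymp (c • X) := by
  unfold IsSymp at *
  rw [transpose_smul, smul_mul_assoc, mul_smul_comm, ← smul_add, hX, smul_zero]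

theorem IsSymp.sub {X Y : Matrix (Fin m ⊕ Fin m) (Fin m ⊕ Fin m) ℂ} (hX : IsSymp X)
    (hY : IsSymp Y) : IsSymp (X - Y) := by
  simpa [sub_eq_add_neg] using hX.add (hY.smul (-1))

theorem isSymp_mul_sympJ {M : Matrix (Fin m ⊕ Fin m) (Fin m ⊕ Fin m) ℂ} (hM : Mᵀ = M) :
    IsSymp (M * sympJ m) := by
  rw [IsSymp, transpose_mul, hM, sympJ_transpose, mul_assoc, sympJ_mul_self, neg_mul, mul_neg,
    mul_neg, ← mul_assoc, sympJ_mul_self]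
  noncomm_ring

/-- The elements of `sp` attached to pairs of basis vectors. -/
noncomputable def rootElt (i j : Fin m ⊕ Fin m) : Matrix (Fin m ⊕ Fin m) (Fin m ⊕ Fin m) ℂ :=
  (single i j 1 + single j i 1) * sympJ m

theorem rootElt_comm (i j : Fin m ⊕ Fin m) : rootElt i j = rootElt j i := by
  rw [rootElt, add_comm, rootElt]

theorem isSymp_rootElt (i j : Fin m ⊕ Fin m) : IsSymp (rootElt i j) :=
  isSymp_mul_sympJ (by rw [transpose_add, transpose_single, transpose_single, add_comm])

theorem sympJ_apply (i j : Fin m ⊕ Fin m) :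
    sympJ m i j = if j = i.swap then (if i.isLeft then 1 else -1) else 0 := by
  rcases i with i | i <;> rcases j with j | j <;>
    simp [sympJ, one_apply, eq_comm]
  split_ifs <;> simp

theorem sympJ_apply_swap (i j : Fin m ⊕ Fin m) : sympJ m j i = -sympJ m i j :=
  congrFun (congrFun (sympJ_transpose m) i) j

theorem sympJ_apply_eq_zero {i j : Fin m ⊕ Fin m} (h : j ≠ i.swap) : sympJ m i j = 0 := by
  rw [sympJ_apply, if_neg h]

theorem rootElt_lie (i j k l : Fin m ⊕ Fin m) :
    rootElt i j * rootElt k l - rootElt k l * rootElt i j =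
      sympJ m j k • rootElt i l + sympJ m j l • rootElt i k + sympJ m i k • rootElt j l +
        sympJ m i l • rootElt j k := by
  have h : ∀ i j k l : Fin m ⊕ Fin m, rootElt i j * rootElt k l =
      (sympJ m j k • single i l 1 + sympJ m j l • single i k 1 + sympJ m i k • single j l 1 +
        sympJ m i l • single j k 1) * sympJ m := by
    intro i j k l
    have h1 : ∀ a b c d : Fin m ⊕ Fin m, single a b (1 : ℂ) * sympJ m * single c d 1 =
        sympJ m b c • single a d 1 := by
      intro a b c d
      rw [single_mul_mul_single, smul_single]
      simp
    rw [rootElt, rootElt, ← mul_assoc, add_mul, add_mul, mul_add, mul_add, h1, h1, h1, h1]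
    congr 1
    abel
  rw [h, h, sympJ_apply_swap j k, sympJ_apply_swap i k, sympJ_apply_swap j l, sympJ_apply_swap i l,
    ← sub_mul]
  simp only [rootElt, ← smul_mul_assoc, ← add_mul, smul_add]
  congr 1
  module

theorem rootElt_mulVec_single (i j k : Fin m ⊕ Fin m) :
    rootElt i j *ᵥ Pi.single k 1 =
      sympJ m j k • Pi.single i (1 : ℂ) + sympJ m i k • Pi.single j 1 := by
  have h1 : ∀ a b : Fin m ⊕ Fin m, single a b (1 : ℂ) *ᵥ (sympJ m *ᵥ Pi.single k 1) =
      sympJ m b k • Pi.single a 1 := by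
    intro a b
    rw [single_mulVec]
    funext t
    by_cases h : t = a
    · subst h; simp
    · simp [h]
  rw [rootElt, ← mulVec_mulVec, add_mulVec, h1, h1]

/-- The diagonal elements of `sp`. -/
noncomputable def coroot (a : Fin m) : Matrix (Fin m ⊕ Fin m) (Fin m ⊕ Fin m) ℂ :=
  diagonal fun i => (stdWeight i a : ℂ)

theorem coroot_eq (a : Fin m) : coroot a = -rootElt (Sum.inl a) (Sum.inr a) := by
  ext i j
  have h1 : ∀ b c : Fin m ⊕ Fin m, (single b c (1 : ℂ) * sympJ m) i j =
      if i = b then sympJ m c j else 0 := by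
    intro b c
    by_cases h : i = b
    · subst h; simp
    · simp [h]
  rw [rootElt, add_mul, Matrix.neg_apply, Matrix.add_apply, h1, h1, sympJ_apply, sympJ_apply,
    coroot, diagonal_apply]
  rcases i with i | i <;> rcases j with j | j <;>
    simp [stdWeight, Pi.single_apply, eq_comm]
  all_goals split_ifs <;> simp_all

theorem isSymp_coroot (a : Fin m) : IsSymp (coroot a) := by
  rw [coroot_eq, ← neg_one_smul ℂ]
  exact (isSymp_rootElt _ _).smul _

theorem coroot_conjTranspose (a : Fin m) : (coroot a)ᴴ = coroot a := by
  rw [coroot, diagonal_conjTranspose]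
  congr 1
  funext i
  simp

theorem sympJ_mul_coroot (a : Fin m) : sympJ m * coroot a = -(coroot a * sympJ m) := by
  ext i j
  rw [Matrix.neg_apply, coroot, mul_diagonal, diagonal_mul, sympJ_apply]
  split_ifs with h
  · rw [h, stdWeight_swap]; simp
  · rw [h, stdWeight_swap]; simp
  · simp

theorem coroot_lie_rootElt (a : Fin m) (i j : Fin m ⊕ Fin m) :
    coroot a * rootElt i j - rootElt i j * coroot a =
      ((stdWeight i a + stdWeight j a : ℤ) : ℂ) • rootElt i j := by
  have h1 : ∀ b c : Fin m ⊕ Fin m, coroot a * single b c (1 : ℂ) =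
      (stdWeight b a : ℂ) • single b c 1 := by
    intro b c
    ext s t
    rw [coroot, diagonal_mul, Matrix.smul_apply, single_apply]
    split_ifs with h
    · simp [h.1]
    · simp
  have h2 : ∀ b c : Fin m ⊕ Fin m, single b c (1 : ℂ) * coroot a =
      (stdWeight c a : ℂ) • single b c 1 := by
    intro b c
    ext s t
    rw [coroot, mul_diagonal, Matrix.smul_apply, single_apply]
    split_ifs with h
    · simp [h.2]
    · simp
  rw [rootElt, mul_assoc _ (sympJ m), sympJ_mul_coroot, mul_neg, sub_neg_eq_add, ← mul_assoc,
    ← mul_assoc, ← add_mul, mul_add, add_mul (single i j 1) (single j i 1) (coroot a), h1, h1, h2, h2,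
    ← smul_mul_assoc]
  congr 1
  push_cast
  module

theorem coroot_commute (a b : Fin m) : coroot a * coroot b = coroot b * coroot a := by
  rw [coroot, coroot, diagonal_mul_diagonal, diagonal_mul_diagonal]
  congr 1
  funext i
  ring

theorem sum_stdWeight_smul_coroot (i : Fin m ⊕ Fin m) :
    ∑ a, (stdWeight i a : ℂ) • coroot a = single i i 1 + sympJ m * single i i 1 * sympJ m := by
  ext k l
  have h0 : (sympJ m * single i i (1 : ℂ) * sympJ m) k l = sympJ m k i * sympJ m i l := by
    rw [mul_assoc, mul_apply, Finset.sum_eq_single i]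
    · simp
    · intro b _ hb; simp [hb]
    · simp
  have h2 : (∑ a, (stdWeight i a : ℂ) • coroot a) k l =
      if k = l then ((stdWeight i ⬝ᵥ stdWeight k : ℤ) : ℂ) else 0 := by
    rw [Matrix.sum_apply]
    simp only [Matrix.smul_apply, coroot, diagonal_apply, smul_eq_mul, mul_ite, mul_zero]
    split_ifs
    · simp [dotProduct]
    · simp
  rw [h2, Matrix.add_apply, h0, stdWeight_dotProduct, sympJ_apply_swap, sympJ_apply,
    sympJ_apply, single_apply]
  rcases i with i | i <;> rcases k with k | k <;> rcases l with l | l <;> simp [eq_comm] <;>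
    split_ifs <;> grind

/-- With `M = E_ij + E_ji` the commutator is `M² + J M² J`, and `M²` is `4 E_ii` or `E_ii + E_jj`;
hence `c` is `2` or `1`. Positivity of `c` drives `SpRep.sub_mem_weights`. -/
theorem rootElt_lie_conjTranspose (i j : Fin m ⊕ Fin m) :
    ∃ c : ℝ, 0 < c ∧ rootElt i j * (rootElt i j)ᴴ - (rootElt i j)ᴴ * rootElt i j =
      (c : ℂ) • (∑ a, (stdWeight i a : ℂ) • coroot a + ∑ a, (stdWeight j a : ℂ) • coroot a) := by
  set M : Matrix (Fin m ⊕ Fin m) (Fin m ⊕ Fin m) ℂ := single i j 1 + single j i 1 with hM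
  have hMH : Mᴴ = M := by
    rw [hM, conjTranspose_add, conjTranspose_single, conjTranspose_single, star_one, add_comm]
  have h1 : rootElt i j * (rootElt i j)ᴴ - (rootElt i j)ᴴ * rootElt i j =
      M * M + sympJ m * (M * M) * sympJ m := by
    rw [rootElt, ← hM, conjTranspose_mul, hMH, sympJ_conjTranspose]
    have h2 : M * sympJ m * (-sympJ m * M) = -(M * (sympJ m * sympJ m) * M) := by noncomm_ring
    rw [h2, sympJ_mul_self]
    noncomm_ring
  simp only [sum_stdWeight_smul_coroot]
  rw [h1]
  by_cases hij : i = j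
  · refine ⟨2, two_pos, ?_⟩
    have h2 : M * M = (4 : ℂ) • single i i 1 := by
      rw [hM, ← hij, ← two_smul ℂ, smul_mul_smul_comm, single_mul_single_same]
      norm_num
    rw [h2, ← hij, mul_smul_comm, smul_mul_assoc]
    push_cast
    module
  · refine ⟨1, one_pos, ?_⟩
    have h2 : M * M = single i i 1 + single j j 1 := by
      rw [hM, add_mul, mul_add, mul_add, single_mul_single_same, single_mul_single_same,
        single_mul_single_of_ne _ _ _ _ (Ne.symm hij), single_mul_single_of_ne _ _ _ _ hij]
      simp
    rw [h2, mul_add, add_mul]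
    push_cast
    module

theorem IsSymp.eq_sum_rootElt {X : Matrix (Fin m ⊕ Fin m) (Fin m ⊕ Fin m) ℂ} (hX : IsSymp X) :
    X = ∑ i, ∑ j, (-(1 / 2 : ℂ) * (X * sympJ m) i j) • rootElt i j := by
  set N := X * sympJ m with hN
  have hNT : Nᵀ = N := by
    rw [hN, transpose_mul, sympJ_transpose, neg_mul]
    exact (eq_neg_of_add_eq_zero_left hX).symm
  have h1 : X = -(N * sympJ m) := by rw [hN, mul_assoc, sympJ_mul_self]; simp
  have h2 : N = ∑ i, ∑ j, N i j • single i j (1 : ℂ) := by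
    nth_rewrite 1 [matrix_eq_sum_single N]
    refine Finset.sum_congr rfl fun i _ => Finset.sum_congr rfl fun j _ => ?_
    rw [smul_single]; simp
  have h3 : N = ∑ i, ∑ j, N i j • single j i (1 : ℂ) := by
    nth_rewrite 1 [h2]
    rw [Finset.sum_comm]
    refine Finset.sum_congr rfl fun i _ => Finset.sum_congr rfl fun j _ => ?_
    rw [show N j i = N i j from congrFun (congrFun hNT i) j]
  have h4 : N = (1 / 2 : ℂ) • ∑ i, ∑ j, N i j • (single i j (1 : ℂ) + single j i 1) := by
    simp only [smul_add, Finset.sum_add_distrib]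
    rw [← h2, ← h3]
    module
  rw [h1]
  nth_rewrite 1 [h4]
  simp only [rootElt, smul_mul_assoc, Finset.sum_mul, mul_smul, Finset.smul_sum, neg_smul,
    Finset.sum_neg_distrib, neg_mul]

theorem isSymp_vecMulVec_mul (x : Fin m ⊕ Fin m → ℂ) : IsSymp (vecMulVec x x * sympJ m) :=
  isSymp_mul_sympJ (by rw [transpose_vecMulVec])

end ComplexSp
end QubitNetwork

namespace QubitNetwork

/-! ### Unitary representations of `sp` and their weights -/

section Integrality

variable {V : Type*} [AddCommGroup V] [Module ℂ V] [FiniteDimensional ℂ V]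

/-- Applying `e` raises the eigenvalue by `2` and must end after finitely many steps. The last
nonzero vector is primitive, so its eigenvalue `μ + 2k` is a natural number. -/
theorem exists_int_eigenvalue_of_isSl2Triple {h e f : Module.End ℂ V} (t : IsSl2Triple h e f)
    {v : V} (hv : v ≠ 0) {μ : ℂ} (hμ : h v = μ • v) : ∃ z : ℤ, μ = z := by
  have hpow : ∀ k : ℕ, h ((e ^ k) v) = (μ + 2 * k) • (e ^ k) v := by
    intro k
    induction k with
    | zero => simpa using hμ
    | succ k ih =>
      have h1 : h * e - e * h = 2 • e := t.lie_h_e_nsmul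
      have h2 : h * e = e * h + 2 • e := by rw [← h1]; abel
      rw [pow_succ', Module.End.mul_apply, ← Module.End.mul_apply h e, h2, LinearMap.add_apply,
        Module.End.mul_apply, ih, map_smul, LinearMap.smul_apply]
      push_cast
      module
  obtain ⟨k, hk1, hk2⟩ : ∃ k : ℕ, (e ^ k) v ≠ 0 ∧ (e ^ (k + 1)) v = 0 := by
    by_contra! hc
    have hne : ∀ k : ℕ, (e ^ k) v ≠ 0 := by
      intro k
      induction k with
      | zero => simpa using hv
      | succ k ih => exact hc k ih
    have hinj : Function.Injective fun k : ℕ => μ + 2 * (k : ℂ) := by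
      intro a b hab
      simpa using hab
    refine Set.infinite_range_of_injective hinj ((Module.End.finite_hasEigenvalue h).subset ?_)
    rintro _ ⟨k, rfl⟩
    exact Module.End.hasEigenvalue_of_hasEigenvector
      ⟨Module.End.mem_eigenspace_iff.2 (hpow k), hne k⟩
  have hprim : t.HasPrimitiveVectorWith ((e ^ k) v) (μ + 2 * k) :=
    ⟨hk1, hpow k, by rw [pow_succ'] at hk2; exact hk2⟩
  obtain ⟨N, hN⟩ := hprim.exists_nat
  exact ⟨N - 2 * k, by push_cast; rw [← hN]; ring⟩

end Integrality

/-- A `*`-representation of the complex symplectic Lie algebra. -/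
structure SpRep (m : ℕ) (κ : Type*) [Fintype κ] where
  toLin : Matrix (Fin m ⊕ Fin m) (Fin m ⊕ Fin m) ℂ →ₗ[ℂ] Matrix κ κ ℂ
  map_lie : ∀ X Y, IsSymp X → IsSymp Y →
    toLin (X * Y - Y * X) = toLin X * toLin Y - toLin Y * toLin X
  map_star : ∀ X, IsSymp X → toLin Xᴴ = (toLin X)ᴴ

namespace SpRep

variable {m : ℕ} {κ : Type*} [Fintype κ] (F : SpRep m κ)

/-- Weight vectors of weight `μ` (including `0`). -/
def IsWeightVector (μ : Fin m → ℤ) (v : κ → ℂ) : Prop :=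
  ∀ a, F.toLin (coroot a) *ᵥ v = (μ a : ℂ) • v

/-- The weights of a representation. -/
def weights : Set (Fin m → ℤ) := {μ | ∃ v, v ≠ 0 ∧ F.IsWeightVector μ v}

theorem coroot_isHermitian (a : Fin m) : (F.toLin (coroot a))ᴴ = F.toLin (coroot a) := by
  rw [← F.map_star _ (isSymp_coroot a), coroot_conjTranspose]

theorem coroot_lie_rootElt (a : Fin m) (i j : Fin m ⊕ Fin m) :
    F.toLin (coroot a) * F.toLin (rootElt i j) - F.toLin (rootElt i j) * F.toLin (coroot a) =
      ((stdWeight i a + stdWeight j a : ℤ) : ℂ) • F.toLin (rootElt i j) := by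
  rw [← F.map_lie _ _ (isSymp_coroot a) (isSymp_rootElt i j), QubitNetwork.coroot_lie_rootElt,
    map_smul]

variable {F}

theorem IsWeightVector.rootElt_mulVec {μ : Fin m → ℤ} {v : κ → ℂ} (hv : F.IsWeightVector μ v)
    (i j : Fin m ⊕ Fin m) :
    F.IsWeightVector (μ + stdWeight i + stdWeight j) (F.toLin (rootElt i j) *ᵥ v) := by
  intro a
  rw [mulVec_mulVec, eq_add_of_sub_eq (F.coroot_lie_rootElt a i j), add_mulVec, ← mulVec_mulVec,
    hv a, mulVec_smul, smul_mulVec]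
  simp only [Pi.add_apply]
  push_cast
  module

theorem IsWeightVector.conjTranspose_rootElt_mulVec {μ : Fin m → ℤ} {v : κ → ℂ}
    (hv : F.IsWeightVector μ v) (i j : Fin m ⊕ Fin m) :
    F.IsWeightVector (μ - stdWeight i - stdWeight j) ((F.toLin (rootElt i j))ᴴ *ᵥ v) := by
  intro a
  have h1 := congrArg conjTranspose (F.coroot_lie_rootElt a i j)
  rw [conjTranspose_sub, conjTranspose_mul, conjTranspose_mul, F.coroot_isHermitian,
    conjTranspose_smul] at h1
  have h2 : F.toLin (coroot a) * (F.toLin (rootElt i j))ᴴ =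
      (F.toLin (rootElt i j))ᴴ * F.toLin (coroot a) -
        star ((stdWeight i a + stdWeight j a : ℤ) : ℂ) •
          (F.toLin (rootElt i j))ᴴ := by
    rw [← h1]; abel
  rw [mulVec_mulVec, h2, sub_mulVec, ← mulVec_mulVec, hv a, mulVec_smul, smul_mulVec]
  simp only [Pi.sub_apply, star_intCast]
  push_cast
  module

theorem IsWeightVector.sum_smul_coroot {μ : Fin m → ℤ} {v : κ → ℂ} (hv : F.IsWeightVector μ v)
    (i : Fin m ⊕ Fin m) :
    F.toLin (∑ a, (stdWeight i a : ℂ) • coroot a) *ᵥ v =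
      ((stdWeight i ⬝ᵥ μ : ℤ) : ℂ) • v := by
  rw [map_sum, Matrix.sum_mulVec]
  simp only [map_smul, smul_mulVec, hv _, smul_smul]
  rw [← Finset.sum_smul]
  simp [dotProduct]

-- Let `E` be the image of `rootElt i j`. If `Eᴴ v = 0`, then pairing `[E, Eᴴ] v` with `v` gives
-- `-‖E v‖² = c (⟨ε_i, μ⟩ + ⟨ε_j, μ⟩) ‖v‖²`, whose sides have opposite signs unless `v = 0`.
open scoped ComplexOrder in
theorem sub_mem_weights {μ : Fin m → ℤ} (hμ : μ ∈ F.weights) (i j : Fin m ⊕ Fin m)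
    (h : 0 < stdWeight i ⬝ᵥ μ + stdWeight j ⬝ᵥ μ) :
    μ - stdWeight i - stdWeight j ∈ F.weights := by
  obtain ⟨v, hv0, hv⟩ := hμ
  refine ⟨(F.toLin (rootElt i j))ᴴ *ᵥ v, fun h0 => hv0 ?_, hv.conjTranspose_rootElt_mulVec i j⟩
  obtain ⟨c, hc, hS⟩ := rootElt_lie_conjTranspose i j
  have h1 := congrArg (fun X => F.toLin X *ᵥ v) hS
  simp only [map_smul, map_add, smul_mulVec, add_mulVec, hv.sum_smul_coroot] at h1
  rw [F.map_lie _ _ (isSymp_rootElt i j) (isSymp_rootElt i j).conjTranspose,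
    F.map_star _ (isSymp_rootElt i j), sub_mulVec, ← mulVec_mulVec, h0, mulVec_zero, zero_sub,
    ← mulVec_mulVec] at h1
  have h2 := congrArg (fun w => star v ⬝ᵥ w) h1
  simp only [dotProduct_neg, dotProduct_smul, dotProduct_add, ← star_mulVec_dotProduct,
    smul_eq_mul] at h2
  have h3 := dotProduct_star_self_nonneg v
  have h4 := dotProduct_star_self_nonneg (F.toLin (rootElt i j) *ᵥ v)
  obtain ⟨r, hr, hr'⟩ := RCLike.nonneg_iff_exists_ofReal.1 h3
  obtain ⟨s, hs, hs'⟩ := RCLike.nonneg_iff_exists_ofReal.1 h4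
  rw [← hr', ← hs'] at h2
  have h5 : -s = c * (((stdWeight i ⬝ᵥ μ : ℤ) : ℝ) * r + ((stdWeight j ⬝ᵥ μ : ℤ) : ℝ) * r) := by
    have := congrArg Complex.re h2
    simpa using this
  have h6 : (0 : ℝ) < ((stdWeight i ⬝ᵥ μ : ℤ) : ℝ) + ((stdWeight j ⬝ᵥ μ : ℤ) : ℝ) := by
    exact_mod_cast h
  have h7 : r = 0 := by
    by_contra hne
    have hr0 : 0 < r := lt_of_le_of_ne hr (Ne.symm hne)
    have := mul_pos hc (mul_pos h6 hr0)
    nlinarith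
  rw [h7] at hr'
  exact dotProduct_star_self_eq_zero.1 (hr'.symm.trans (by simp))

theorem IsWeightVector.dotProduct_eq_zero {μ ν : Fin m → ℤ} {v w : κ → ℂ}
    (hv : F.IsWeightVector μ v) (hw : F.IsWeightVector ν w) (h : μ ≠ ν) : star v ⬝ᵥ w = 0 := by
  obtain ⟨a, ha⟩ := Function.ne_iff.1 h
  have h1 := star_mulVec_dotProduct (F.toLin (coroot a)) v w
  rw [F.coroot_isHermitian, hv a, hw a, star_smul, smul_dotProduct, dotProduct_smul, star_intCast,
    ← sub_eq_zero, ← sub_smul] at h1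
  refine (smul_eq_zero.1 h1).resolve_left ?_
  exact sub_ne_zero.2 (by exact_mod_cast ha)

/-- Weight vectors of different weights are orthogonal, since the diagonal elements act by Hermitian
matrices. -/
theorem card_le_of_injective_weights {τ : Type*} [Fintype τ] {g : τ → Fin m → ℤ}
    (hg : Function.Injective g) (hmem : ∀ t, g t ∈ F.weights) :
    Fintype.card τ ≤ Fintype.card κ := by
  choose v hv0 hv using hmem
  have hli : LinearIndependent ℂ fun t => (WithLp.toLp 2 (v t) : EuclideanSpace ℂ κ) := by
    refine linearIndependent_of_ne_zero_of_inner_eq_zero (fun t h => hv0 t ?_) fun s t hst => ?_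
    · simpa using h
    · change inner ℂ _ _ = _
      rw [EuclideanSpace.inner_eq_star_dotProduct, dotProduct_comm]
      exact (hv s).dotProduct_eq_zero (hv t) (hg.ne hst)
  simpa using hli.fintype_card_le_finrank

/-- The eigenvalues of the diagonal elements are integers. -/
theorem exists_int_of_coroot_mulVec [DecidableEq κ] (a : Fin m) {v : κ → ℂ} (hv : v ≠ 0) {c : ℂ}
    (h : F.toLin (coroot a) *ᵥ v = c • v) : ∃ z : ℤ, c = z := by
  -- Treated apart because `IsSl2Triple` requires a nonzero `h`.
  by_cases h0 : F.toLin (coroot a) = 0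
  · rw [h0, zero_mulVec] at h
    exact ⟨0, by simpa using (smul_eq_zero.1 h.symm).resolve_right hv⟩
  -- The long roots `±2ε_a`, scaled by `±1/2`, complete the image of `coroot a` to an `sl₂` triple.
  set E := (1 / 2 : ℂ) • F.toLin (rootElt (Sum.inl a) (Sum.inl a)) with hE
  set E' := (-1 / 2 : ℂ) • F.toLin (rootElt (Sum.inr a) (Sum.inr a)) with hE'
  have h1 : E * E' - E' * E = F.toLin (coroot a) := by
    have h2 := F.map_lie _ _ (isSymp_rootElt (Sum.inl a) (Sum.inl a))
      (isSymp_rootElt (Sum.inr a) (Sum.inr a))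
    rw [rootElt_lie, sympJ_apply] at h2
    simp only [Sum.swap_inl, Sum.isLeft_inl, if_true, one_smul] at h2
    rw [hE, hE', smul_mul_smul_comm, smul_mul_smul_comm, mul_comm (-1 / 2 : ℂ), ← smul_sub, ← h2,
      ← map_smul, coroot_eq]
    congr 1
    module
  have h2 : F.toLin (coroot a) * E - E * F.toLin (coroot a) = 2 • E := by
    have := F.coroot_lie_rootElt a (Sum.inl a) (Sum.inl a)
    rw [hE, mul_smul_comm, smul_mul_assoc, ← smul_sub, this,
      show stdWeight (Sum.inl a) a + stdWeight (Sum.inl a) a = 2 by simp [stdWeight]]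
    push_cast
    module
  have h3 : F.toLin (coroot a) * E' - E' * F.toLin (coroot a) = -(2 • E') := by
    have := F.coroot_lie_rootElt a (Sum.inr a) (Sum.inr a)
    rw [hE', mul_smul_comm, smul_mul_assoc, ← smul_sub, this,
      show stdWeight (Sum.inr a) a + stdWeight (Sum.inr a) a = -2 by simp [stdWeight]]
    push_cast
    module
  have t : IsSl2Triple (Matrix.toLinAlgEquiv' (F.toLin (coroot a))) (Matrix.toLinAlgEquiv' E)
      (Matrix.toLinAlgEquiv' E') := by
    refine ⟨?_, ?_, ?_, ?_⟩
    · simpa using h0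
    · rw [Ring.lie_def, ← map_mul, ← map_mul, ← map_sub, h1]
    · rw [Ring.lie_def, ← map_mul, ← map_mul, ← map_sub, h2, map_nsmul]
    · rw [Ring.lie_def, ← map_mul, ← map_mul, ← map_sub, h3, map_neg, map_nsmul]
  exact exists_int_eigenvalue_of_isSl2Triple t hv (by simpa using h)

/-- The commuting Hermitian images of the coroots have joint eigenspaces spanning the whole space,
and the joint eigenvalues are integral, hence weights. Were they all zero, the image of `coroot a`
would vanish. -/
theorem exists_ne_zero_mem_weights [DecidableEq κ] {a : Fin m} (ha : F.toLin (coroot a) ≠ 0) :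
    ∃ μ ∈ F.weights, μ ≠ 0 := by
  by_contra! hc
  let T : Fin m → EuclideanSpace ℂ κ →ₗ[ℂ] EuclideanSpace ℂ κ := fun b =>
    Matrix.toEuclideanLin (F.toLin (coroot b))
  have hsymm : ∀ b, (T b).IsSymmetric := fun b =>
    Matrix.isSymmetric_toEuclideanLin_iff.2 (F.coroot_isHermitian b)
  have hT : ∀ b (v : EuclideanSpace ℂ κ), (T b v).ofLp = F.toLin (coroot b) *ᵥ v.ofLp :=
    fun b v => rfl
  have hcomm : Pairwise (Function.onFun Commute T) := by
    intro b c _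
    have h1 := F.map_lie _ _ (isSymp_coroot b) (isSymp_coroot c)
    rw [coroot_commute, sub_self, map_zero, eq_comm, sub_eq_zero] at h1
    refine LinearMap.ext fun v => WithLp.ofLp_injective 2 ?_
    change F.toLin (coroot b) *ᵥ (F.toLin (coroot c) *ᵥ v.ofLp) =
      F.toLin (coroot c) *ᵥ (F.toLin (coroot b) *ᵥ v.ofLp)
    rw [mulVec_mulVec, mulVec_mulVec, h1]
  have htop := LinearMap.IsSymmetric.iSup_iInf_eq_top_of_commute hsymm hcomm
  have hker : (⊤ : Submodule ℂ (EuclideanSpace ℂ κ)) ≤ LinearMap.ker (T a) := by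
    rw [← htop]
    refine iSup_le fun χ v hv => ?_
    rw [Submodule.mem_iInf] at hv
    have hv' : ∀ b, F.toLin (coroot b) *ᵥ v.ofLp = χ b • v.ofLp := fun b =>
      congrArg WithLp.ofLp (Module.End.mem_eigenspace_iff.1 (hv b))
    by_cases hv0 : v = 0
    · simp [hv0]
    have hv0' : v.ofLp ≠ 0 := by simpa using hv0
    choose z hz using fun b => exists_int_of_coroot_mulVec b hv0' (hv' b)
    have h1 := hc z ⟨v.ofLp, hv0', fun b => by rw [hv' b, hz b]⟩
    rw [LinearMap.mem_ker]
    refine WithLp.ofLp_injective 2 ?_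
    rw [hT, hv' a, hz a, h1]
    simp
  apply ha
  refine Matrix.toEuclideanLin.injective ?_
  rw [map_zero]
  exact LinearMap.ker_eq_top.1 (top_le_iff.1 hker)

theorem weights_eq_range [DecidableEq κ] (hm : 2 ≤ m) (hκ : Fintype.card κ = 2 * m) {a : Fin m}
    (ha : F.toLin (coroot a) ≠ 0) : F.weights = Set.range stdWeight :=
  eq_range_stdWeight hm (exists_ne_zero_mem_weights ha) (fun _ hμ i j h => sub_mem_weights hμ i j h)
    fun _ _ _ hg hmem => hκ ▸ card_le_of_injective_weights hg hmem

end SpRep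
end QubitNetwork

namespace QubitNetwork

/-! ### The representation of `sp` of minimal dimension -/

namespace SpRep

variable {m : ℕ} {κ : Type*} [Fintype κ] {F : SpRep m κ}

theorem IsWeightVector.eq_zero {μ : Fin m → ℤ} {v : κ → ℂ} (hv : F.IsWeightVector μ v)
    (hμ : μ ∉ F.weights) : v = 0 := by
  by_contra h
  exact hμ ⟨v, h, hv⟩

variable (F) in
/-- The matrix of the map from the standard representation that sends `e_l` to the weight
vector `v`. -/
noncomputable def intertwiner (l : Fin m ⊕ Fin m) (v : κ → ℂ) : Matrix κ (Fin m ⊕ Fin m) ℂ :=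
  Matrix.of fun x k => ((if k = l.swap then (1 / 2 : ℂ) else 1) • sympJ m l l.swap •
    -(F.toLin (rootElt k l.swap) *ᵥ v)) x

theorem intertwiner_mulVec_single (l k : Fin m ⊕ Fin m) (v : κ → ℂ) :
    F.intertwiner l v *ᵥ Pi.single k 1 = (if k = l.swap then (1 / 2 : ℂ) else 1) •
      sympJ m l l.swap • -(F.toLin (rootElt k l.swap) *ᵥ v) := by
  rw [mulVec_single_one]
  rfl

theorem sympJ_swap_mul_self (l : Fin m ⊕ Fin m) : sympJ m l l.swap * sympJ m l l.swap = 1 := by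
  rw [sympJ_apply]
  rcases l with l | l <;> simp

theorem swap_ne_self (l : Fin m ⊕ Fin m) : l.swap ≠ l := by
  rcases l with l | l <;> simp

theorem swap_eq_comm {i j : Fin m ⊕ Fin m} : i = j.swap ↔ j = i.swap := by
  constructor <;> (rintro rfl; rw [Sum.swap_swap])

section

variable (hF : F.weights = Set.range stdWeight) {l : Fin m ⊕ Fin m} {v : κ → ℂ}
  (hv : F.IsWeightVector (stdWeight l) v)

include hv in
theorem rootElt_swap_mulVec (i : Fin m ⊕ Fin m) :
    F.toLin (rootElt i i.swap) *ᵥ v =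
      (sympJ m i.swap i * ((stdWeight i ⬝ᵥ stdWeight l : ℤ) : ℂ)) • v := by
  rcases i with a | a
  · have h1 := hv a
    rw [coroot_eq, map_neg, neg_mulVec, neg_eq_iff_eq_neg] at h1
    rw [Sum.swap_inl, h1, sympJ_apply]
    simp [stdWeight]
  · have h1 := hv a
    rw [coroot_eq, map_neg, neg_mulVec, neg_eq_iff_eq_neg, rootElt_comm] at h1
    rw [Sum.swap_inr, h1, sympJ_apply]
    simp [stdWeight]

include hv in
theorem intertwiner_mulVec_self : F.intertwiner l v *ᵥ Pi.single l 1 = v := by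
  rw [intertwiner_mulVec_single, if_neg (swap_ne_self l).symm, one_smul, rootElt_swap_mulVec hv,
    stdWeight_dotProduct_self, sympJ_apply_swap l l.swap, ← neg_smul, smul_smul]
  rw [Int.cast_one, mul_one, neg_neg, sympJ_swap_mul_self, one_smul]

-- The image would have weight `ε_i + ε_j + ε_k`, which is not a weight by `eq_stdWeight_of_sum_eq`.
include hF in
theorem rootElt_mulVec_eq_zero {k : Fin m ⊕ Fin m} {w : κ → ℂ}
    (hw : F.IsWeightVector (stdWeight k) w) {i j : Fin m ⊕ Fin m} (h1 : j ≠ i.swap)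
    (h2 : j ≠ k.swap) (h3 : i ≠ k.swap) : F.toLin (rootElt i j) *ᵥ w = 0 := by
  refine (hw.rootElt_mulVec i j).eq_zero ?_
  rw [hF]
  rintro ⟨t, ht⟩
  rw [add_rotate, add_comm, ← add_assoc] at ht
  rcases eq_stdWeight_of_sum_eq (i := i) (j := j) (k := k) (t := t)
    (by rw [ht]; abel) with h | h | h
  exacts [h1 h, h2 h, h3 h]

-- If `l.swap` is among the indices, this is how `intertwiner` is defined. Otherwise `rootElt i j`
-- kills `e_l` when `i` and `j` differ from `l.swap`, and it kills `v` by weights: the weight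
-- pairing is zero for a diagonal element, and the target is no weight in the other case.
include hF hv in
theorem rootElt_mulVec_eq_intertwiner (i j : Fin m ⊕ Fin m) :
    F.toLin (rootElt i j) *ᵥ v = F.intertwiner l v *ᵥ (rootElt i j *ᵥ Pi.single l 1) := by
  have hJ : sympJ m l.swap l = -sympJ m l l.swap := sympJ_apply_swap _ _
  have hdef : ∀ k, F.toLin (rootElt k l.swap) *ᵥ v =
      F.intertwiner l v *ᵥ (rootElt k l.swap *ᵥ Pi.single l 1) := by
    intro k
    rw [rootElt_mulVec_single, mulVec_add, mulVec_smul, mulVec_smul, intertwiner_mulVec_single,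
      intertwiner_mulVec_single, if_pos rfl, hJ]
    by_cases hk : k = l.swap
    · rw [hk, if_pos rfl, hJ]
      have := sympJ_swap_mul_self l
      funext x
      simp only [Pi.add_apply, Pi.smul_apply, Pi.neg_apply, smul_eq_mul]
      linear_combination (-(F.toLin (rootElt l.swap l.swap) *ᵥ v) x) * this
    · rw [if_neg hk, sympJ_apply_eq_zero fun h => hk (swap_eq_comm.1 h)]
      have := sympJ_swap_mul_self l
      funext x
      simp only [Pi.add_apply, Pi.smul_apply, Pi.neg_apply, smul_eq_mul]
      linear_combination (-(F.toLin (rootElt k l.swap) *ᵥ v) x) * this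
  by_cases hj : j = l.swap
  · rw [hj]; exact hdef i
  by_cases hi : i = l.swap
  · rw [hi, rootElt_comm]; exact hdef j
  rw [rootElt_mulVec_single, sympJ_apply_eq_zero fun h => hj (swap_eq_comm.1 h),
    sympJ_apply_eq_zero fun h => hi (swap_eq_comm.1 h), zero_smul, zero_smul, add_zero, mulVec_zero]
  by_cases hij : j = i.swap
  · rw [hij, rootElt_swap_mulVec hv, stdWeight_dotProduct, if_neg hi,
      if_neg fun h : i = l => hj (by rw [hij, h])]
    simp
  · exact rootElt_mulVec_eq_zero hF hv hij hj hi

include hF hv in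
theorem mulVec_eq_intertwiner {X : Matrix (Fin m ⊕ Fin m) (Fin m ⊕ Fin m) ℂ} (hX : IsSymp X) :
    F.toLin X *ᵥ v = F.intertwiner l v *ᵥ (X *ᵥ Pi.single l 1) := by
  rw [hX.eq_sum_rootElt]
  simp only [map_sum, map_smul, Matrix.sum_mulVec, smul_mulVec, Matrix.mulVec_sum, mulVec_smul,
    rootElt_mulVec_eq_intertwiner hF hv]

/-- `rootElt k l.swap` sends `e_l` to a sign times `e_k`, doubled when `k = l.swap`; hence the
factor `1/2`. The normalization is that of `intertwiner`, whose column `k` is thus `F.toLin Y *ᵥ v`.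
-/
theorem exists_isSymp_mulVec_single (l k : Fin m ⊕ Fin m) :
    ∃ Y, IsSymp Y ∧ Y *ᵥ Pi.single l (1 : ℂ) = Pi.single k 1 ∧ ∃ c : ℂ, Y = c • rootElt k l.swap := by
  have hJ : sympJ m l.swap l = -sympJ m l l.swap := sympJ_apply_swap _ _
  have h1 := sympJ_swap_mul_self l
  by_cases hk : k = l.swap
  · refine ⟨(-(1 / 2) * sympJ m l l.swap) • rootElt k l.swap, (isSymp_rootElt _ _).smul _, ?_,
      _, rfl⟩
    rw [smul_mulVec, rootElt_mulVec_single, hk, hJ]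
    funext x
    simp only [Pi.add_apply, Pi.smul_apply, smul_eq_mul]
    linear_combination (Pi.single (M := fun _ => ℂ) l.swap 1 x) * h1
  · refine ⟨(-sympJ m l l.swap) • rootElt k l.swap, (isSymp_rootElt _ _).smul _, ?_, _, rfl⟩
    rw [smul_mulVec, rootElt_mulVec_single, hJ,
      sympJ_apply_eq_zero fun h => hk (swap_eq_comm.1 h)]
    funext x
    simp only [Pi.add_apply, Pi.smul_apply, smul_eq_mul]
    linear_combination (Pi.single (M := fun _ => ℂ) k 1 x) * h1

-- Column `k` of the intertwiner is `Y v`, and `X Y v = [X, Y] v + Y X v`. The first term is known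
-- from the action on `v`, the second because `X` scales `v`.
include hF hv in
theorem mul_intertwiner_of_stabilizer {X : Matrix (Fin m ⊕ Fin m) (Fin m ⊕ Fin m) ℂ}
    (hX : IsSymp X) {c : ℂ} (hc : X *ᵥ Pi.single l 1 = c • Pi.single l 1) :
    F.toLin X * F.intertwiner l v = F.intertwiner l v * X := by
  refine Matrix.ext_of_mulVec_single fun k => ?_
  obtain ⟨Y, hY, hYl, -⟩ := exists_isSymp_mulVec_single l k
  have hΦY : F.intertwiner l v *ᵥ Pi.single k 1 = F.toLin Y *ᵥ v := by
    rw [mulVec_eq_intertwiner hF hv hY, hYl]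
  have hXv : F.toLin X *ᵥ v = c • v := by
    rw [mulVec_eq_intertwiner hF hv hX, hc, mulVec_smul, intertwiner_mulVec_self hv]
  have hlie : IsSymp (X * Y - Y * X) := by
    have h1 : X * sympJ m = -(sympJ m * Xᵀ) := eq_neg_of_add_eq_zero_left hX
    have h2 : Y * sympJ m = -(sympJ m * Yᵀ) := eq_neg_of_add_eq_zero_left hY
    have h3 : X * Y * sympJ m = sympJ m * (Xᵀ * Yᵀ) := by
      rw [mul_assoc, h2, mul_neg, ← mul_assoc, h1, neg_mul, neg_neg, mul_assoc]
    have h4 : Y * X * sympJ m = sympJ m * (Yᵀ * Xᵀ) := by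
      rw [mul_assoc, h1, mul_neg, ← mul_assoc, h2, neg_mul, neg_neg, mul_assoc]
    rw [IsSymp, transpose_sub, transpose_mul, transpose_mul, sub_mul, h3, h4]
    noncomm_ring
  have h5 := mulVec_eq_intertwiner hF hv hlie
  rw [F.map_lie X Y hX hY, sub_mulVec, sub_mulVec, ← mulVec_mulVec, ← mulVec_mulVec, hXv,
    mulVec_smul, ← mulVec_mulVec, ← mulVec_mulVec, hYl, hc, mulVec_smul, hYl, mulVec_sub,
    mulVec_smul, hΦY, sub_left_inj] at h5
  rw [← mulVec_mulVec, hΦY, h5, mulVec_mulVec]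

-- Elements without the index `l.swap` kill `e_l`, and the pair `(l.swap, l)` scales it, so the
-- stabilizer lemma applies. For `(l.swap, l.swap)` all weight vectors except that of `ε_l` are
-- killed on both sides. The remaining `(l.swap, j)` are multiples of commutators of `(l.swap,
-- l.swap)` with `(l, j)`.
include hF hv in
theorem rootElt_mul_intertwiner (i j : Fin m ⊕ Fin m) :
    F.toLin (rootElt i j) * F.intertwiner l v = F.intertwiner l v * rootElt i j := by
  have hstab : ∀ i j : Fin m ⊕ Fin m, i ≠ l.swap → j ≠ l.swap →
      F.toLin (rootElt i j) * F.intertwiner l v = F.intertwiner l v * rootElt i j := by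
    intro i j hi hj
    refine mul_intertwiner_of_stabilizer hF hv (isSymp_rootElt i j) (c := 0) ?_
    rw [rootElt_mulVec_single, sympJ_apply_eq_zero fun h => hj (swap_eq_comm.1 h),
      sympJ_apply_eq_zero fun h => hi (swap_eq_comm.1 h)]
    simp
  have hlow : F.toLin (rootElt l.swap l.swap) * F.intertwiner l v =
      F.intertwiner l v * rootElt l.swap l.swap := by
    refine Matrix.ext_of_mulVec_single fun k => ?_
    rw [← mulVec_mulVec, ← mulVec_mulVec]
    by_cases hk : k = l
    · rw [hk, intertwiner_mulVec_self hv, rootElt_mulVec_eq_intertwiner hF hv]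
    have hw : F.IsWeightVector (stdWeight k) (F.intertwiner l v *ᵥ Pi.single k 1) := by
      intro a
      obtain ⟨Y, hY, hYl, c, rfl⟩ := exists_isSymp_mulVec_single l k
      have h1 := (hv.rootElt_mulVec k l.swap) a
      rw [stdWeight_swap, show stdWeight l + stdWeight k + -stdWeight l = stdWeight k by abel] at h1
      rw [← hYl, ← mulVec_eq_intertwiner hF hv hY, map_smul, smul_mulVec, mulVec_smul, h1, smul_comm]
    have hkl : l.swap ≠ k.swap := fun h => hk (by rw [← Sum.swap_swap k, ← h, Sum.swap_swap])
    rw [rootElt_mulVec_eq_zero hF hw (fun h => swap_ne_self _ h.symm) hkl hkl,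
      rootElt_mulVec_single, sympJ_apply_eq_zero fun h => hk (by rw [h, Sum.swap_swap])]
    simp
  have hmix : ∀ j, F.toLin (rootElt l.swap j) * F.intertwiner l v =
      F.intertwiner l v * rootElt l.swap j := by
    intro j
    by_cases hj : j = l.swap
    · rw [hj]; exact hlow
    by_cases hjl : j = l
    · rw [hjl]
      refine mul_intertwiner_of_stabilizer hF hv (isSymp_rootElt _ _) (c := sympJ m l.swap l) ?_
      rw [rootElt_mulVec_single, sympJ_apply_eq_zero (swap_ne_self l).symm]
      simp
    have h1 := hstab l j (swap_ne_self l).symm hj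
    have h2 : sympJ m l.swap j = 0 := sympJ_apply_eq_zero fun h => hjl (by rw [h, Sum.swap_swap])
    have h3 := rootElt_lie l.swap l.swap l j
    rw [h2, zero_smul, add_zero, add_zero, ← two_smul ℂ, smul_smul] at h3
    have h4 := F.map_lie _ _ (isSymp_rootElt l.swap l.swap) (isSymp_rootElt l j)
    rw [h3, map_smul] at h4
    have hc : (2 * sympJ m l.swap l : ℂ) ≠ 0 := by
      rw [sympJ_apply]
      rcases l with l | l <;> simp
    have h5 : (2 * sympJ m l.swap l : ℂ) • (F.toLin (rootElt l.swap j) * F.intertwiner l v) =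
        (2 * sympJ m l.swap l : ℂ) • (F.intertwiner l v * rootElt l.swap j) := by
      rw [← Matrix.smul_mul, h4, ← Matrix.mul_smul, ← h3, Matrix.sub_mul, Matrix.mul_sub,
        Matrix.mul_assoc, h1, ← Matrix.mul_assoc, hlow, Matrix.mul_assoc, Matrix.mul_assoc, hlow,
        ← Matrix.mul_assoc (F.toLin (rootElt l j)), h1]
      simp only [Matrix.mul_assoc]
    exact smul_right_injective _ hc h5
  by_cases hi : i = l.swap
  · rw [hi]; exact hmix j
  by_cases hj : j = l.swap
  · rw [hj, rootElt_comm]; exact hmix i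
  exact hstab i j hi hj

include hF hv in
theorem mul_intertwiner {X : Matrix (Fin m ⊕ Fin m) (Fin m ⊕ Fin m) ℂ} (hX : IsSymp X) :
    F.toLin X * F.intertwiner l v = F.intertwiner l v * X := by
  rw [hX.eq_sum_rootElt]
  simp only [map_sum, map_smul, Matrix.sum_mul, Matrix.mul_sum, Matrix.smul_mul, Matrix.mul_smul,
    rootElt_mul_intertwiner hF hv]

-- A direct Schur argument: `ΦᴴΦ` commutes with the complex symplectic algebra, which is stable
-- under adjoints and contains the rank-one matrices `x xᵀ J`. Commuting with these makes every `x`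
-- an eigenvector.
include hF hv in
theorem conjTranspose_intertwiner_mul :
    ∃ c : ℂ, (F.intertwiner l v)ᴴ * F.intertwiner l v = c • 1 := by
  have hcomm : ∀ X, IsSymp X → X * ((F.intertwiner l v)ᴴ * F.intertwiner l v) =
      ((F.intertwiner l v)ᴴ * F.intertwiner l v) * X := by
    intro X hX
    have h1 := congrArg conjTranspose (mul_intertwiner hF hv hX.conjTranspose)
    rw [conjTranspose_mul, conjTranspose_mul, F.map_star X hX, conjTranspose_conjTranspose,
      conjTranspose_conjTranspose] at h1
    rw [← Matrix.mul_assoc, ← h1, Matrix.mul_assoc, mul_intertwiner hF hv hX, Matrix.mul_assoc]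
  generalize (F.intertwiner l v)ᴴ * F.intertwiner l v = Q at hcomm
  refine exists_eq_smul_one_of_forall_mulVec fun x => ?_
  by_cases hx : x = 0
  · exact ⟨0, by simp [hx]⟩
  have h1 := hcomm _ (isSymp_vecMulVec_mul x)
  have h3 : (vecMulVec x x * sympJ m) *ᵥ (-(sympJ m *ᵥ star x)) = (star x ⬝ᵥ x) • x := by
    rw [← mulVec_mulVec, mulVec_neg, mulVec_mulVec, sympJ_mul_self, neg_mulVec, neg_neg, one_mulVec,
      vecMulVec_mulVec_eq_smul, dotProduct_comm]
  generalize -(sympJ m *ᵥ star x) = z at h3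
  have h2 := congrArg (fun Y => Y *ᵥ z) h1
  simp only [← mulVec_mulVec, vecMulVec_mulVec_eq_smul, mulVec_smul] at h2
  rw [← mulVec_mulVec, vecMulVec_mulVec_eq_smul] at h3
  have hxx : x ⬝ᵥ (sympJ m *ᵥ z) ≠ 0 := by
    intro h
    rw [h, zero_smul, eq_comm, smul_eq_zero] at h3
    open scoped ComplexOrder in
    exact hx (h3.elim dotProduct_star_self_eq_zero.1 id)
  refine ⟨(x ⬝ᵥ (sympJ m *ᵥ z))⁻¹ * (x ⬝ᵥ (sympJ m *ᵥ (Q *ᵥ z))), ?_⟩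
  rw [mul_smul, h2, smul_smul, inv_mul_cancel₀ hxx, one_smul]

end

end SpRep
end QubitNetwork

namespace QubitNetwork

/-! ### Complexification of skew-Hermitian representations, and transitivity for `sp` -/

section Complexification

variable {m : ℕ} {κ : Type*} [Fintype κ]

theorem smul_add_I_smul {W : Type*} [AddCommGroup W] [Module ℂ W] (c : ℂ) (P Q : W) :
    c • (P + Complex.I • Q) = ((c.re : ℂ) • P - (c.im : ℂ) • Q) +
      Complex.I • ((c.re : ℂ) • Q + (c.im : ℂ) • P) := by
  have hI : ∀ w : W, Complex.I • Complex.I • w = -w := fun w => by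
    rw [smul_smul, Complex.I_mul_I, neg_one_smul]
  conv_lhs => rw [← Complex.re_add_im c]
  simp only [smul_add, add_smul, mul_smul, hI, smul_comm _ Complex.I]
  abel

theorem commutator_add_I_smul {R : Type*} [Ring R] [Algebra ℂ R] (P Q P' Q' : R) :
    (P + Complex.I • Q) * (P' + Complex.I • Q') - (P' + Complex.I • Q') * (P + Complex.I • Q) =
      ((P * P' - P' * P) - (Q * Q' - Q' * Q)) +
        Complex.I • ((P * Q' - Q' * P) + (Q * P' - P' * Q)) := by
  have hI : ∀ M : R, Complex.I • Complex.I • M = -M := fun M => by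
    rw [smul_smul, Complex.I_mul_I, neg_one_smul]
  simp only [mul_add, add_mul, smul_mul_assoc, mul_smul_comm, smul_add, smul_sub, hI]
  abel

theorem exists_skew_add_I_smul_skew {ι : Type*} (X : Matrix ι ι ℂ) :
    ∃ P Q : Matrix ι ι ℂ, Pᴴ = -P ∧ Qᴴ = -Q ∧ X = P + Complex.I • Q ∧
      P = (1 / 2 : ℂ) • (X - Xᴴ) ∧ Q = (-Complex.I / 2) • (X + Xᴴ) := by
  refine ⟨_, _, ?_, ?_, ?_, rfl, rfl⟩
  · rw [conjTranspose_smul, conjTranspose_sub, conjTranspose_conjTranspose]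
    simp
    module
  · rw [conjTranspose_smul, conjTranspose_add, conjTranspose_conjTranspose]
    simp
    module
  · rw [smul_smul, show Complex.I * (-Complex.I / 2) = 1 / 2 by
      linear_combination (-1 / 2 : ℂ) * Complex.I_mul_I]
    module

theorem skew_add_I_smul_skew_unique {ι : Type*} {P Q : Matrix ι ι ℂ} (hP : Pᴴ = -P)
    (hQ : Qᴴ = -Q) :
    (1 / 2 : ℂ) • ((P + Complex.I • Q) - (P + Complex.I • Q)ᴴ) = P ∧
      (-Complex.I / 2) • ((P + Complex.I • Q) + (P + Complex.I • Q)ᴴ) = Q := by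
  have h : (P + Complex.I • Q)ᴴ = -P + Complex.I • Q := by
    rw [conjTranspose_add, conjTranspose_smul, hP, hQ]
    simp
  rw [h]
  constructor
  · module
  · rw [show P + Complex.I • Q + (-P + Complex.I • Q) = (2 * Complex.I) • Q by module, smul_smul,
      show -Complex.I / 2 * (2 * Complex.I) = 1 by linear_combination -Complex.I_mul_I, one_smul]

theorem mem_sp_of_isSymp {X : Matrix (Fin m ⊕ Fin m) (Fin m ⊕ Fin m) ℂ} (hX : IsSymp X)
    (h : Xᴴ = -X) : X ∈ sp m := ⟨⟨h, hX.trace_eq_zero⟩, hX⟩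

/-- A representation of the compact form by skew-Hermitian matrices extends to the complex
symplectic Lie algebra. -/
theorem exists_spRep [DecidableEq κ] (f : sp m →ₗ⁅ℝ⁆ Matrix κ κ ℂ) (hf : ∀ X, (f X)ᴴ = -f X) :
    ∃ F : SpRep m κ, ∀ X : sp m, F.toLin X = f X := by
  obtain ⟨g, hg⟩ := LinearMap.exists_extend (p := (sp m).toSubmodule) (f : sp m →ₗ[ℝ] Matrix κ κ ℂ)
  have hgf : ∀ X (hX : X ∈ sp m), g X = f ⟨X, hX⟩ := fun X hX =>
    LinearMap.congr_fun hg ⟨X, hX⟩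
  have hgstar : ∀ X ∈ sp m, (g X)ᴴ = -g X := fun X hX => by rw [hgf X hX, hf]
  have hglie : ∀ X ∈ sp m, ∀ Y ∈ sp m, g (X * Y - Y * X) = g X * g Y - g Y * g X := by
    intro X hX Y hY
    have h1 := f.map_lie ⟨X, hX⟩ ⟨Y, hY⟩
    rw [Ring.lie_def, ← hgf X hX, ← hgf Y hY] at h1
    rw [← h1]
    exact hgf _ ((sp m).lie_mem hX hY)
  -- With `X = P + iQ` split into skew-Hermitian `P` and `Q`, this is `g P + i g Q`. The arbitrary
  -- real-linear extension `g` makes it defined, and complex linear, on all matrices; brackets and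
  -- adjoints are respected only on the symplectic ones.
  let G : Matrix (Fin m ⊕ Fin m) (Fin m ⊕ Fin m) ℂ → Matrix κ κ ℂ := fun X =>
    g ((1 / 2 : ℂ) • (X - Xᴴ)) + Complex.I • g ((-Complex.I / 2) • (X + Xᴴ))
  have hG : ∀ P Q : Matrix (Fin m ⊕ Fin m) (Fin m ⊕ Fin m) ℂ, Pᴴ = -P → Qᴴ = -Q →
      G (P + Complex.I • Q) = g P + Complex.I • g Q := by
    intro P Q hP hQ
    simp only [G]
    rw [(skew_add_I_smul_skew_unique hP hQ).1, (skew_add_I_smul_skew_unique hP hQ).2]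
  have hdecomp : ∀ X, IsSymp X → ∃ P ∈ sp m, ∃ Q ∈ sp m, X = P + Complex.I • Q := by
    intro X hX
    obtain ⟨P, Q, hP, hQ, hXPQ, hP', hQ'⟩ := exists_skew_add_I_smul_skew X
    refine ⟨P, mem_sp_of_isSymp ?_ hP, Q, mem_sp_of_isSymp ?_ hQ, hXPQ⟩
    · rw [hP']; exact (hX.sub hX.conjTranspose).smul _
    · rw [hQ']; exact (hX.add hX.conjTranspose).smul _
  let F : Matrix (Fin m ⊕ Fin m) (Fin m ⊕ Fin m) ℂ →ₗ[ℂ] Matrix κ κ ℂ :=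
    { toFun := G
      map_add' := fun X Y => by
        simp only [G, conjTranspose_add]
        rw [show (1 / 2 : ℂ) • (X + Y - (Xᴴ + Yᴴ)) =
            (1 / 2 : ℂ) • (X - Xᴴ) + (1 / 2 : ℂ) • (Y - Yᴴ) by module,
          show (-Complex.I / 2) • (X + Y + (Xᴴ + Yᴴ)) =
            (-Complex.I / 2) • (X + Xᴴ) + (-Complex.I / 2) • (Y + Yᴴ) by module, map_add, map_add]
        module
      map_smul' := fun c X => by
        obtain ⟨P, Q, hP, hQ, rfl, -, -⟩ := exists_skew_add_I_smul_skew X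
        have h1 : c • (P + Complex.I • Q) =
            (c.re • P - c.im • Q) + Complex.I • (c.re • Q + c.im • P) := by
          simp only [← Complex.coe_smul]
          exact smul_add_I_smul c P Q
        rw [h1, hG _ _ (by
          rw [conjTranspose_sub, conjTranspose_smul, conjTranspose_smul, hP, hQ]
          simp only [star_trivial]; module) (by
          rw [conjTranspose_add, conjTranspose_smul, conjTranspose_smul, hP, hQ]
          simp only [star_trivial]; module), RingHom.id_apply, hG _ _ hP hQ]
        simp only [map_sub, map_add, map_smul]
        simp only [← Complex.coe_smul]
        exact (smul_add_I_smul c (g P) (g Q)).symm }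
  refine ⟨⟨F, ?_, ?_⟩, ?_⟩
  · intro X Y hX hY
    obtain ⟨P, hP, Q, hQ, rfl⟩ := hdecomp X hX
    obtain ⟨R, hR, S, hS, rfl⟩ := hdecomp Y hY
    change G _ = G _ * G _ - G _ * G _
    have m1 : ∀ X ∈ sp m, ∀ Y ∈ sp m, X * Y - Y * X ∈ sp m := fun X hX Y hY =>
      (sp m).lie_mem hX hY
    rw [commutator_add_I_smul, hG _ _ ((sp m).sub_mem (m1 P hP R hR) (m1 Q hQ S hS)).1.1
      ((sp m).add_mem (m1 P hP S hS) (m1 Q hQ R hR)).1.1, hG _ _ hP.1.1 hQ.1.1,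
      hG _ _ hR.1.1 hS.1.1, map_sub, map_add, hglie P hP R hR, hglie Q hQ S hS, hglie P hP S hS,
      hglie Q hQ R hR, commutator_add_I_smul]
  · intro X hX
    obtain ⟨P, hP, Q, hQ, rfl⟩ := hdecomp X hX
    change G _ = (G _)ᴴ
    have h1 : (P + Complex.I • Q)ᴴ = -P + Complex.I • Q := by
      rw [conjTranspose_add, conjTranspose_smul, hP.1.1, hQ.1.1]
      simp
    rw [h1, hG _ _ (by rw [conjTranspose_neg, hP.1.1]) hQ.1.1, hG _ _ hP.1.1 hQ.1.1,
      conjTranspose_add, conjTranspose_smul, hgstar P hP, hgstar Q hQ, map_neg]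
    simp
  · intro X
    change G _ = _
    have h1 := hG X.1 0 X.2.1.1 (by simp)
    rw [smul_zero, add_zero, map_zero, smul_zero, add_zero] at h1
    rw [h1, hgf X.1 X.2]

end Complexification

/-- A Lie algebra of skew-Hermitian `2m × 2m` matrices isomorphic to `sp m` acts transitively. -/
theorem transitiveUpToPhase_of_equiv_sp {m : ℕ} (hm : 2 ≤ m) {κ : Type*} [Fintype κ]
    [DecidableEq κ] {L : LieSubalgebra ℝ (Matrix κ κ ℂ)} (hL : ∀ X ∈ L, Xᴴ = -X)
    (e : L ≃ₗ⁅ℝ⁆ sp m) (hκ : Fintype.card κ = 2 * m) : TransitiveUpToPhase L := by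
  obtain ⟨F, hF⟩ := exists_spRep (L.incl.comp (e.symm : sp m →ₗ⁅ℝ⁆ L))
    fun X => hL _ (e.symm X).2
  have hF' : ∀ X (hX : X ∈ sp m), F.toLin X = (e.symm ⟨X, hX⟩ : L) := fun X hX => hF ⟨X, hX⟩
  let a : Fin m := ⟨0, by omega⟩
  -- `i • coroot a` is a nonzero element of `sp m`, and `e.symm` is injective.
  have ha : F.toLin (coroot a) ≠ 0 := by
    intro h
    have hmem : Complex.I • coroot a ∈ sp m := by
      refine mem_sp_of_isSymp ((isSymp_coroot a).smul _) ?_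
      rw [conjTranspose_smul, coroot_conjTranspose]
      simp
    have h1 := hF' _ hmem
    rw [map_smul, h, smul_zero] at h1
    have h2 : e.symm ⟨_, hmem⟩ = 0 := Subtype.ext h1.symm
    have h3 := congrArg Subtype.val ((map_eq_zero_iff e.symm e.symm.injective).1 h2)
    have h4 := congrFun (congrFun h3 (Sum.inl a)) (Sum.inl a)
    simp [coroot, stdWeight] at h4
  have hw := SpRep.weights_eq_range hm hκ ha
  obtain ⟨v, hv0, hv⟩ : stdWeight (Sum.inl a) ∈ F.weights := hw ▸ ⟨_, rfl⟩
  obtain ⟨c, hc⟩ := SpRep.conjTranspose_intertwiner_mul hw hv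
  have hc0 : c ≠ 0 := by
    rintro rfl
    rw [zero_smul] at hc
    open scoped ComplexOrder in
    have h1 := conjTranspose_mul_self_eq_zero.1 hc
    have h2 := SpRep.intertwiner_mulVec_self hv
    rw [h1, zero_mulVec] at h2
    exact hv0 h2.symm
  -- A left inverse is also a right inverse because both index types have `2 * m` elements.
  have hleft : (c⁻¹ • (F.intertwiner (Sum.inl a) v)ᴴ) * F.intertwiner (Sum.inl a) v = 1 := by
    rw [Matrix.smul_mul, hc, smul_smul, inv_mul_cancel₀ hc0, one_smul]
  refine transitiveUpToPhase_of_intertwiner (f := F.toLin) (fun X hX => ?_)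
    ((Matrix.mul_eq_one_comm_of_card_eq _ _ _ (by simp [hκ, two_mul])).1 hleft) hc
    fun X hX => SpRep.mul_intertwiner hw hv hX.2
  rw [hF' X hX]
  exact (e.symm ⟨X, hX⟩).2

theorem conjTranspose_eq_neg_of_mem_generatedLieAlgebra {n p : ℕ} {A : Operator n}
    {B : Fin p → Operator n} (hA : Aᴴ = -A) (hB : ∀ l, (B l)ᴴ = -B l) :
    ∀ X ∈ generatedLieAlgebra A B, Xᴴ = -X := by
  intro X hX
  induction hX using LieSubalgebra.lieSpan_induction with
  | mem x h =>
    rcases h with rfl | ⟨l, rfl⟩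
    exacts [hA, hB l]
  | zero => simp
  | add x y _ _ hx hy => rw [conjTranspose_add, hx, hy, neg_add]
  | smul c x _ hx => rw [conjTranspose_smul, hx, star_trivial, smul_neg]
  | lie x y _ _ hx hy =>
    rw [Ring.lie_def, conjTranspose_sub, conjTranspose_mul, conjTranspose_mul, hx, hy]
    noncomm_ring

end QubitNetwork

theorem proposition3 (n p : ℕ) (hn : 1 ≤ n)
    (H₀ : Matrix (Fin 2) (Fin 2) ℂ)
    (A : QubitNetwork.Operator n) (B : Fin p → QubitNetwork.Operator n)
    (hA : Aᴴ = -A) (hB : ∀ l, (B l)ᴴ = -B l)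
    (hAH : A = Complex.I • QubitNetwork.tensorPower n H₀)
    (T : ℝ) (hT : 0 < T)
    (hL : Nonempty (QubitNetwork.generatedLieAlgebra A B ≃ₗ⁅ℝ⁆ QubitNetwork.sp (2 ^ (n - 1))) ∨
      Nonempty (QubitNetwork.generatedLieAlgebra A B ≃ₗ⁅ℝ⁆ QubitNetwork.su (Fin (2 ^ n))))
    (hR : QubitNetwork.reachableWithin A B T =
      QubitNetwork.expGroup (QubitNetwork.generatedLieAlgebra A B)) :
    QubitNetwork.IsEquivalentStateControllable A B T := by
  refine QubitNetwork.isEquivalentStateControllable_of_transitive hn hA hAH hR ?_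
  have hskew := QubitNetwork.conjTranspose_eq_neg_of_mem_generatedLieAlgebra hA hB
  obtain ⟨k, rfl⟩ : ∃ k, n = k + 1 := ⟨n - 1, by omega⟩
  rw [Nat.add_sub_cancel] at hL
  rcases hL with ⟨⟨e⟩⟩ | ⟨⟨e⟩⟩
  -- The weight count needs `m ≥ 2`, so a single qubit is treated through `sp 1 = su`.
  · rcases Nat.eq_zero_or_pos k with rfl | hk
    · have h1 : QubitNetwork.sp 1 = QubitNetwork.su (Fin 1 ⊕ Fin 1) :=
        le_antisymm (fun X hX => hX.1) QubitNetwork.su_le_sp_one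
      rw [pow_zero, h1] at e
      exact QubitNetwork.transitiveUpToPhase_of_equiv_su hskew e (by simp)
    · exact QubitNetwork.transitiveUpToPhase_of_equiv_sp
        (Nat.le_self_pow hk.ne' 2) hskew e (by simp [pow_succ, mul_comm])
  · exact QubitNetwork.transitiveUpToPhase_of_equiv_su hskew e (by simp)
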